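/- Let $X$ be a Fano manifold of dimension $n$: a compact connected complex manifold whose anticanonical bundle $L=-K_X$ carries a smooth Hermitian metric $h_0$ whose Chern curvature form $\omega_0=-\frac{i}{2\pi}\partial\bar\partial\log h_0$ is positive; fix such an $h_0$. Let $V=\int_X\omega_0^n$, let $\rho_0$ be the Ricci potential, i.e. the smooth function with $\mathrm{Ric}(\omega_0)-\omega_0=\frac{i}{2\pi}\partial\bar\partial\rho_0$ (where $\mathrm{Ric}(\omega_0)=-\frac{i}{2\pi}\partial\bar\partial\log\det(\omega_0)$) and $\int_X(e^{\rho_0}-1)\,\omega_0^n=0$, and put $d\mu_0=e^{\rho_0}\omega_0^n$. For a real function $\phi$ on $X$, representing the fiber metric $h_0e^{-\phi}$, put $$L(\phi)=-\log\Big(\frac1V\int_X e^{-\phi}\,d\mu_0\Big),\qquad d\mu_\phi=\frac{e^{-\phi}\,d\mu_0}{\int_X e^{-\phi}\,d\mu_0}.$$ Let $k\ge 1$ be an integer such that $-kK_X$ is globally generated, let $N_k=\dim H^0(X,-kK_X)$, and let $\mathcal H_k$ be the set of positive definite Hermitian inner products on $H^0(X,-kK_X)$. For $H\in\mathcal H_k$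 with orthonormal basis $s_1,\dots,s_{N_k}$, let $$f_k(H)=\frac1k\log\Big(\frac1{N_k}\sum_{i}|s_i|_{h_0^k}^2\Big),\qquad b_k(H)(s,s')=\int_X h_0^k(s,s')\,e^{-kf_k(H)}\,d\mu_{f_k(H)},$$ and let $$S_k(H)=\frac1{N_k}\,\mathrm{Tr}\; b_k(H)\big(\log b_k(H)-\log H\big)$$ be the quantized entropy, where Hermitian forms are identified with their matrices in an $H$-orthonormal basis. A curve $(H_t)_{t\in\mathbb R}$ in $\mathcal H_k$ is a geodesic if it is one for the invariant metric $\langle A,B\rangle_H=\mathrm{Tr}(H^{-1}AH^{-1}B)$, i.e. if $\ddot H=\dot HH^{-1}\dot H$; its weights are the real numbers $\lambda_1,\dots,\lambda_{N_k}$ such that for some basis $s_i$ of $H^0(X,-kK_X)$ the sections $e^{\lambda_it/2}s_i$ form an $H_t$-orthonormal basis for every $t$. Then for every $H_0\in\mathcal H_k$ and every geodesic $H_t$ emanating from $H_0$ with weights $\lambda_i$, the function $t\mapsto L(f_k(H_t))$ is differentiable at $t=0$, and $$S_k(H_0)\;\le\;\sup_{H_t}\Big\{-\frac{d}{dt}\Big|_{t=0}L(f_k(H_t))-\log\Big(\frac1{N_k}\sum_{i=1}^{N_k}e^{-\lambda_i/k}\Big)\Big\},$$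 where the supremum runs over all geodesics $H_t$ emanating from $H_0$ and is finite. -/

import Mathlib

open scoped Manifold ContDiff Matrix ComplexConjugate ComplexOrder
open MeasureTheory Set

noncomputable section

namespace QuantizedEntropy

/-! ### The powers of the anticanonical line bundle and their holomorphic sections

A complex manifold of dimension `n` is modelled on `Fin n → ℂ`. -/

section Bundle

variable (n : ℕ) (X : Type*) [TopologicalSpace X] [ChartedSpace (Fin n → ℂ) X]
  [IsManifold 𝓘(ℂ, Fin n → ℂ) ω X]

/-- The line bundle `-k K_X = (Λⁿ TX)^{⊗ k}`, presented by its transition functions: the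
`k`-th powers of the determinants of the transition maps of the holomorphic tangent bundle.
In the trivialization given by a chart with coordinates `z_1, …, z_n`, the number `1` stands for
the frame `(∂/∂z_1 ∧ … ∧ ∂/∂z_n)^{⊗ k}`. -/
def antiCanonicalCore (k : ℕ) : VectorBundleCore ℂ X ℂ (atlas (Fin n → ℂ) X) where
  baseSet i := i.1.source
  isOpen_baseSet i := i.1.open_source
  indexAt := achart (Fin n → ℂ)
  mem_baseSet_at := mem_chart_source (Fin n → ℂ)
  coordChange i j x :=
    (((tangentBundleCore 𝓘(ℂ, Fin n → ℂ) X).coordChange i j x).det ^ k) •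
      ContinuousLinearMap.id ℂ ℂ
  coordChange_self i x hx v := by
    have h : (tangentBundleCore 𝓘(ℂ, Fin n → ℂ) X).coordChange i i x =
        ContinuousLinearMap.id ℂ (Fin n → ℂ) := by
      ext1 w
      exact (tangentBundleCore 𝓘(ℂ, Fin n → ℂ) X).coordChange_self i x hx w
    rw [h]
    have h1 : (ContinuousLinearMap.id ℂ (Fin n → ℂ)).det = 1 := by
      simp [ContinuousLinearMap.det]
    rw [h1]
    simp
  continuousOn_coordChange i j := by
    have h := (tangentBundleCore 𝓘(ℂ, Fin n → ℂ) X).continuousOn_coordChange i j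
    have h2 := (ContinuousLinearMap.continuous_det (𝕜 := ℂ) (E := Fin n → ℂ)).comp_continuousOn h
    exact (h2.pow k).smul continuousOn_const
  coordChange_comp i j l x hx v := by
    have h : ((tangentBundleCore 𝓘(ℂ, Fin n → ℂ) X).coordChange j l x).comp
        ((tangentBundleCore 𝓘(ℂ, Fin n → ℂ) X).coordChange i j x) =
        (tangentBundleCore 𝓘(ℂ, Fin n → ℂ) X).coordChange i l x := by
      ext1 w
      exact (tangentBundleCore 𝓘(ℂ, Fin n → ℂ) X).coordChange_comp i j l x hx w
    rw [← h]
    have h1 : ∀ A B : (Fin n → ℂ) →L[ℂ] (Fin n → ℂ), (A.comp B).det = A.det * B.det := by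
      intro A B
      simp [ContinuousLinearMap.det]
    rw [h1, mul_pow]
    simp [mul_assoc]

/-- The space `H⁰(X, -k K_X)` of global holomorphic sections. -/
abbrev PluriSection (k : ℕ) : Type _ :=
  ContMDiffSection 𝓘(ℂ, Fin n → ℂ) ℂ ω (antiCanonicalCore n X k).Fiber

/-- The dimension `N_k` of `H⁰(X, -k K_X)`. -/
def sectionDim (k : ℕ) : ℕ := Module.finrank ℂ (PluriSection n X k)

variable {n X}

/-- The coefficient of a section at `x`, with respect to the frame
`(∂/∂z_1 ∧ … ∧ ∂/∂z_n)^{⊗ k}` of the preferred chart at `x`. -/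
def coeff {k : ℕ} (s : PluriSection n X k) (x : X) : ℂ := s x

/-! ### Fiber metrics on `-K_X`, their curvature, and the Ricci potential -/

/-- If `w x` is the squared length of `∂/∂z_1 ∧ … ∧ ∂/∂z_n` at `x` for the preferred chart at `x`,
then `localWeight w e` is, on the target of the chart `e`, the squared length of the frame
`∂/∂z_1 ∧ … ∧ ∂/∂z_n` of the coordinates of `e`. -/
def localWeight (w : X → ℝ) (e : atlas (Fin n → ℂ) X) (z : Fin n → ℂ) : ℝ :=
  w (e.1.symm z) *
    ‖(antiCanonicalCore n X 1).coordChange e (achart (Fin n → ℂ) (e.1.symm z)) (e.1.symm z) 1‖ ^ 2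

variable (n X) in
/-- A smooth Hermitian fiber metric on `-K_X`. -/
structure HermitianMetric where
  /-- the squared length of the frame of the preferred chart -/
  weight : X → ℝ
  weight_pos : ∀ x, 0 < weight x
  smooth : ∀ e : atlas (Fin n → ℂ) X, ContDiffOn ℝ ∞ (localWeight weight e) e.1.target

/-- The Hermitian form `h(s(x), s'(x))` on `-k K_X` induced by the fiber metric `h` of `-K_X`;
it is conjugate linear in `s`. -/
def HermitianMetric.pairing (h : HermitianMetric n X) {k : ℕ} (s s' : PluriSection n X k)
    (x : X) : ℂ :=
  ((h.weight x ^ k : ℝ) : ℂ) * (conj (coeff s x) * coeff s' x)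

/-- `|s(x)|²` with respect to the fiber metric induced by `h` on `-k K_X`. -/
def HermitianMetric.normSq (h : HermitianMetric n X) {k : ℕ} (s : PluriSection n X k)
    (x : X) : ℝ :=
  h.weight x ^ k * ‖coeff s x‖ ^ 2

/-- The complex Hessian `(∂² u / ∂z_j ∂z̄_l)_{j l}` of a real function `u` on `ℂⁿ`, where
`∂/∂z_j = (∂/∂x_j - i ∂/∂y_j) / 2` and `∂/∂z̄_l = (∂/∂x_l + i ∂/∂y_l) / 2`. -/
def complexHessian (u : (Fin n → ℂ) → ℝ) (z : Fin n → ℂ) : Matrix (Fin n) (Fin n) ℂ :=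
  Matrix.of fun j l =>
    let D : (Fin n → ℂ) → (Fin n → ℂ) → ℝ := fun v w => fderiv ℝ (fderiv ℝ u) z v w
    let a : Fin n → (Fin n → ℂ) := fun i => Pi.single i 1
    let b : Fin n → (Fin n → ℂ) := fun i => Pi.single i Complex.I
    (1 / 4 : ℂ) * (((D (a j) (a l) + D (b j) (b l) : ℝ) : ℂ) +
      Complex.I * ((D (a j) (b l) - D (b j) (a l) : ℝ) : ℂ))

/-- The matrix `(g_{j l̄})` of the Chern curvature form
`ω₀ = (i / 2π) ∑ g_{j l̄} dz_j ∧ dz̄_l` of the fiber metric `h`, in the chart `e`. -/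
def HermitianMetric.curvature (h : HermitianMetric n X) (e : atlas (Fin n → ℂ) X)
    (z : Fin n → ℂ) : Matrix (Fin n) (Fin n) ℂ :=
  complexHessian (fun w => - Real.log (localWeight h.weight e w)) z

/-- The fiber metric `h` has positive curvature, i.e. its curvature form is a Kähler form. -/
def HermitianMetric.IsPositive (h : HermitianMetric n X) : Prop :=
  ∀ (e : atlas (Fin n → ℂ) X), ∀ z ∈ e.1.target, (h.curvature e z).PosDef

/-- The matrix of the Ricci form of the curvature form `ω₀` of `h` in the chart `e`,
`Ric(ω₀) = -(i / 2π) ∂∂̄ log det (g_{j l̄})`. -/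
def HermitianMetric.ricci (h : HermitianMetric n X) (e : atlas (Fin n → ℂ) X)
    (z : Fin n → ℂ) : Matrix (Fin n) (Fin n) ℂ :=
  complexHessian (fun w => - Real.log (h.curvature e w).det.re) z

end Bundle

section Quantization

variable {n : ℕ} {X : Type*} [TopologicalSpace X] [CompactSpace X] [T2Space X]
  [ChartedSpace (Fin n → ℂ) X]

variable (n X) in
/-- There is a partition of unity subordinate to the preferred charts. -/
theorem exists_chartPartition :
    ∃ f : PartitionOfUnity X X univ,
      f.IsSubordinate fun x => (chartAt (Fin n → ℂ) x).source :=
  PartitionOfUnity.exists_isSubordinate isClosed_univ _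
    (fun x => (chartAt (Fin n → ℂ) x).open_source)
    (fun x _ => mem_iUnion.2 ⟨x, mem_chart_source _ x⟩)

variable (n X) in
/-- A partition of unity subordinate to the preferred charts. -/
def chartPartition : PartitionOfUnity X X univ := (exists_chartPartition n X).choose

variable [IsManifold 𝓘(ℂ, Fin n → ℂ) ω X] [MeasurableSpace X] [BorelSpace X]

/-- The Monge-Ampère measure `ω₀ⁿ` of the curvature form `ω₀` of `h`. In a chart it is
`n! π⁻ⁿ det (g_{j l̄})` times the Lebesgue measure `∏ dx_j dy_j`, because
`(i / 2π) dz ∧ dz̄ = π⁻¹ dx ∧ dy`; the charts are glued by a partition of unity. -/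
def HermitianMetric.volumeMeasure (h : HermitianMetric n X) : Measure X :=
  Measure.sum fun x : X =>
    Measure.map (chartAt (Fin n → ℂ) x).symm
      ((volume.restrict (chartAt (Fin n → ℂ) x).target).withDensity fun z =>
        ENNReal.ofReal (chartPartition n X x ((chartAt (Fin n → ℂ) x).symm z) *
          ((n.factorial : ℝ) * (Real.pi⁻¹) ^ n *
            (h.curvature (achart (Fin n → ℂ) x) z).det.re)))

/-- `ρ` is the Ricci potential of the curvature form `ω₀` of `h`: a smooth function with
`Ric(ω₀) - ω₀ = (i / 2π) ∂∂̄ ρ` and `∫ (e^ρ - 1) ω₀ⁿ = 0`. -/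
structure IsRicciPotential (h : HermitianMetric n X) (ρ : X → ℝ) : Prop where
  smooth : ContMDiff 𝓘(ℝ, Fin n → ℂ) 𝓘(ℝ, ℝ) ∞ ρ
  equation : ∀ (e : atlas (Fin n → ℂ) X), ∀ z ∈ e.1.target,
    h.ricci e z - h.curvature e z = complexHessian (fun w => ρ (e.1.symm w)) z
  normalized : ∫ x, (Real.exp (ρ x) - 1) ∂h.volumeMeasure = 0

/-- The measure `dμ₀ = e^{ρ₀} ω₀ⁿ`. -/
def baseMeasure (h : HermitianMetric n X) (ρ : X → ℝ) : Measure X :=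
  h.volumeMeasure.withDensity fun x => ENNReal.ofReal (Real.exp (ρ x))

/-- The canonical probability measure `dμ_φ = e^{-φ} dμ₀ / ∫ e^{-φ} dμ₀`. -/
def canonicalMeasure (h : HermitianMetric n X) (ρ φ : X → ℝ) : Measure X :=
  (∫⁻ x, ENNReal.ofReal (Real.exp (-φ x)) ∂baseMeasure h ρ)⁻¹ •
    (baseMeasure h ρ).withDensity fun x => ENNReal.ofReal (Real.exp (-φ x))

/-- The functional `L(φ) = - log (V⁻¹ ∫ e^{-φ} dμ₀)`, where `V = ∫ ω₀ⁿ`. -/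
def lFunctional (h : HermitianMetric n X) (ρ φ : X → ℝ) : ℝ :=
  - Real.log ((h.volumeMeasure.real univ)⁻¹ * ∫ x, Real.exp (-φ x) ∂baseMeasure h ρ)

end Quantization

section Forms

variable {n : ℕ} {X : Type*} [TopologicalSpace X] [ChartedSpace (Fin n → ℂ) X]
  [IsManifold 𝓘(ℂ, Fin n → ℂ) ω X]

variable (n X) in
/-- The set `𝓗_k` of positive definite Hermitian inner products on `H⁰(X, -k K_X)`. They are
conjugate linear in the first variable. -/
abbrev HermForm (k : ℕ) : Type _ := InnerProductSpace.Core ℂ (PluriSection n X k)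

/-- The family `s` is orthonormal for `H`. -/
def IsONB {k : ℕ} (H : HermForm n X k) (s : Fin (sectionDim n X k) → PluriSection n X k) : Prop :=
  ∀ i j, H.inner (s i) (s j) = if i = j then 1 else 0

open Classical in
/-- An orthonormal basis of `H⁰(X, -k K_X)` for `H`. -/
def onb {k : ℕ} (H : HermForm n X k) : Fin (sectionDim n X k) → PluriSection n X k :=
  if hs : ∃ s : Module.Basis (Fin (sectionDim n X k)) ℂ (PluriSection n X k), IsONB H s then
    hs.choose
  else 0

/-- The Fubini-Study map `f_k`. The fiber metric `h₀ e^{-f_k(H)}` is represented by the function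
`f_k(H) = k⁻¹ log (N_k⁻¹ ∑ |s_i|²)`, where `s_i` is an orthonormal basis for `H`. -/
def fubiniStudy (h : HermitianMetric n X) {k : ℕ} (H : HermForm n X k) (x : X) : ℝ :=
  (k : ℝ)⁻¹ * Real.log ((sectionDim n X k : ℝ)⁻¹ * ∑ i, h.normSq (onb H i) x)

/-- A curve `H_t` in `𝓗_k` is a geodesic of the invariant Riemannian metric
`⟨A, B⟩_H = Tr(H⁻¹ A H⁻¹ B)`, i.e. it satisfies `H'' - H' H⁻¹ H' = 0`. Here `A t` is the
endomorphism `H_t⁻¹ H_t'`, so that `H' = H A` and `H' H⁻¹ H' = H A²`. -/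
def IsGeodesic {k : ℕ} (H : ℝ → HermForm n X k) : Prop :=
  ∃ A : ℝ → Module.End ℂ (PluriSection n X k),
    (∀ t u v, HasDerivAt (fun τ => (H τ).inner u v) ((H t).inner u (A t v)) t) ∧
    (∀ t u v, HasDerivAt (fun τ => (H τ).inner u (A τ v)) ((H t).inner u (A t (A t v))) t)

/-- The numbers `lam i` are the weights of the curve `H_t` with respect to the basis `s_i`: the
basis `e^{lam i t / 2} s_i` is orthonormal for `H_t`, for every `t`. -/
def HasWeights {k : ℕ} (H : ℝ → HermForm n X k)
    (s : Module.Basis (Fin (sectionDim n X k)) ℂ (PluriSection n X k))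
    (lam : Fin (sectionDim n X k) → ℝ) : Prop :=
  ∀ t, IsONB (H t) fun i => (Real.exp (lam i / 2 * t) : ℂ) • s i

/-- The relative entropy `Tr A (log A - log B)` of two Hermitian matrices. -/
def relativeEntropy {N : ℕ} (A B : Matrix (Fin N) (Fin N) ℂ) : ℝ :=
  (A * (cfc Real.log A - cfc Real.log B)).trace.re

/-- The matrix of a sesquilinear form with respect to a family of sections. -/
def formMatrix {k : ℕ} (B : PluriSection n X k → PluriSection n X k → ℂ)
    (s : Fin (sectionDim n X k) → PluriSection n X k) :
    Matrix (Fin (sectionDim n X k)) (Fin (sectionDim n X k)) ℂ :=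
  Matrix.of fun i j => B (s i) (s j)

variable [CompactSpace X] [T2Space X] [MeasurableSpace X] [BorelSpace X]

/-- The `L²` form `p_k(φ) = ∫ h₀(·, ·) e^{-k φ} dμ_φ` on `H⁰(X, -k K_X)`. -/
def l2Form (h : HermitianMetric n X) (ρ : X → ℝ) (k : ℕ) (φ : X → ℝ)
    (s s' : PluriSection n X k) : ℂ :=
  ∫ x, h.pairing s s' x * (Real.exp (-(k : ℝ) * φ x) : ℂ) ∂canonicalMeasure h ρ φ

/-- The balancing map `b_k = p_k ∘ f_k`. -/
def balancing (h : HermitianMetric n X) (ρ : X → ℝ) {k : ℕ} (H : HermForm n X k) :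
    PluriSection n X k → PluriSection n X k → ℂ :=
  l2Form h ρ k (fubiniStudy h H)

/-- The quantized entropy `S_k(H) = N_k⁻¹ Tr b_k(H) (log b_k(H) - log H)`, where the forms
are identified with their matrices in an `H`-orthonormal basis. -/
def quantizedEntropy (h : HermitianMetric n X) (ρ : X → ℝ) {k : ℕ} (H : HermForm n X k) : ℝ :=
  (sectionDim n X k : ℝ)⁻¹ *
    relativeEntropy (formMatrix (balancing h ρ H) (onb H)) (formMatrix H.inner (onb H))

/-- The values of `-(d/dt)|_{t=0} L(f_k(H_t)) - log (N_k⁻¹ ∑ e^{-lam i / k})`, where `H_t` is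
a geodesic with `H_0 = H₀`, and `lam i` are its weights. -/
def subtractedSlopes (h : HermitianMetric n X) (ρ : X → ℝ) {k : ℕ} (H₀ : HermForm n X k) : Set ℝ :=
  {v | ∃ (H : ℝ → HermForm n X k)
      (s : Module.Basis (Fin (sectionDim n X k)) ℂ (PluriSection n X k))
      (lam : Fin (sectionDim n X k) → ℝ),
      IsGeodesic H ∧ H 0 = H₀ ∧ HasWeights H s lam ∧
      v = -deriv (fun t => lFunctional h ρ (fubiniStudy h (H t))) 0
        - Real.log ((sectionDim n X k : ℝ)⁻¹ * ∑ i, Real.exp (-lam i / k))}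

end Forms

end QuantizedEntropy

end

/-! Fix an `H₀`-orthonormal basis s_i and put p_i = ∫ |s_i|² / ∑_j |s_j|² dμ, with μ the canonical
measure of f_k(H₀). Then p is a probability vector (`HermitianMetric.sum_density`). Along a geodesic
with weights λ_i in this basis the potential is f_k(H_t) = k⁻¹ log (N⁻¹ ∑ e^{λ_i t} |s_i|²), and
differentiating under the integral gives dL/dt = k⁻¹ ∑ λ_i p_i at t = 0
(`hasDerivAt_lFunctional_fubiniStudy`). With u_i = -λ_i / k, the quantity under the supremum is ∑
p_i u_i - log (N⁻¹ ∑ e^{u_i}). This is the functional of the Gibbs variational principle, whose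
supremum over u is the relative entropy ∑ p_i log (N p_i) of p with respect to the uniform
distribution.

On the other side, e^{-k f_k} = N / ∑ |s_j|², so b_k(H₀)(s_i, s_i) = N p_i. In an orthonormal basis
that diagonalizes b_k(H₀) these numbers are the eigenvalues, and S_k(H₀) = ∑ p_i log (N p_i)
(`exists_basis_quantizedEntropy_eq`). Every real vector of weights in that basis comes from a
geodesic (`exists_isGeodesic`), so one would like to take u_i = log (N p_i). To allow for p_i = 0,
the proof uses u_i = log max(N p_i, ε) instead, at a cost of at most ε (`sum_mul_log_le_add`). The
supremum is finite because u_i ≤ log ∑ e^{u_j} bounds every value by log N.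

The analytic input comes from compactness: H⁰ is finite-dimensional by the Schwarz lemma, and ω₀ⁿ is
a finite nonzero measure, so continuous functions are integrable and the normalizing integrals are
positive. -/

namespace QuantizedEntropy

/-! ### Local representations of pluri-anticanonical sections -/

section Local

variable {n : ℕ} {X : Type*} [TopologicalSpace X] [ChartedSpace (Fin n → ℂ) X]
  [IsManifold 𝓘(ℂ, Fin n → ℂ) ω X]

/-- The determinant of the holomorphic tangent map of a change of charts. -/
noncomputable def transitionDet (i j : atlas (Fin n → ℂ) X) (x : X) : ℂ :=
  ((tangentBundleCore 𝓘(ℂ, Fin n → ℂ) X).coordChange i j x).det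

theorem antiCanonicalCore_coordChange (k : ℕ) (i j : atlas (Fin n → ℂ) X) (x : X) (v : ℂ) :
    (antiCanonicalCore n X k).coordChange i j x v = transitionDet i j x ^ k * v := by
  simp [antiCanonicalCore, transitionDet]

theorem transitionDet_mul_transitionDet {i j : atlas (Fin n → ℂ) X} {x : X}
    (hi : x ∈ i.1.source) (hj : x ∈ j.1.source) :
    transitionDet i j x * transitionDet j i x = 1 := by
  have h := (antiCanonicalCore n X 1).coordChange_comp i j i x ⟨⟨hi, hj⟩, hi⟩ 1
  rw [(antiCanonicalCore n X 1).coordChange_self i x hi] at h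
  simp only [antiCanonicalCore_coordChange, pow_one, mul_one] at h
  rw [mul_comm, h]

/-- By the Leibniz formula the determinant is a polynomial in the matrix entries. -/
theorem contDiff_continuousLinearMap_det {m : ℕ∞ω} :
    ContDiff ℂ m (ContinuousLinearMap.det : ((Fin n → ℂ) →L[ℂ] (Fin n → ℂ)) → ℂ) := by
  have h : (ContinuousLinearMap.det : ((Fin n → ℂ) →L[ℂ] (Fin n → ℂ)) → ℂ) =
      fun A => ∑ σ : Equiv.Perm (Fin n), ((Equiv.Perm.sign σ : ℤ) : ℂ) *
        ∏ i, A (Pi.single i 1) (σ i) := by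
    ext A
    rw [ContinuousLinearMap.det, ← LinearMap.det_toMatrix', Matrix.det_apply']
    simp [LinearMap.toMatrix'_apply]
  rw [h]
  refine ContDiff.sum fun σ _ => contDiff_const.mul (contDiff_prod fun i _ => ?_)
  exact contDiff_pi.1 (contDiff_id.clm_apply contDiff_const) (σ i)

/-- Passing to the tangent bundle costs one derivative, which is harmless here because `ω + 1` is
`ω`. -/
instance tangentBundleCore_isContMDiff_omega :
    (tangentBundleCore 𝓘(ℂ, Fin n → ℂ) X).IsContMDiff 𝓘(ℂ, Fin n → ℂ) ω :=
  have : IsManifold 𝓘(ℂ, Fin n → ℂ) (ω + 1) X := ‹IsManifold 𝓘(ℂ, Fin n → ℂ) ω X›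
  tangentBundleCore.isContMDiff

theorem contMDiffOn_transitionDet (i j : atlas (Fin n → ℂ) X) :
    ContMDiffOn 𝓘(ℂ, Fin n → ℂ) 𝓘(ℂ, ℂ) ω (transitionDet i j) (i.1.source ∩ j.1.source) :=
  contDiff_continuousLinearMap_det.contMDiff.comp_contMDiffOn
    ((tangentBundleCore 𝓘(ℂ, Fin n → ℂ) X).contMDiffOn_coordChange 𝓘(ℂ, Fin n → ℂ) i j)

instance antiCanonicalCore_isContMDiff (k : ℕ) :
    (antiCanonicalCore n X k).IsContMDiff 𝓘(ℂ, Fin n → ℂ) ω where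
  contMDiffOn_coordChange i j :=
    ((contMDiffOn_transitionDet i j).pow k).smul contMDiffOn_const

/-- The coefficient of a section on the target of a chart, with respect to the coordinate frame
of that chart. -/
noncomputable def localRep {k : ℕ} (s : PluriSection n X k) (e : atlas (Fin n → ℂ) X)
    (z : Fin n → ℂ) : ℂ :=
  transitionDet (achart (Fin n → ℂ) (e.1.symm z)) e (e.1.symm z) ^ k * coeff s (e.1.symm z)

theorem contDiffOn_localRep {k : ℕ} (s : PluriSection n X k) (e : atlas (Fin n → ℂ) X) :
    ContDiffOn ℂ ω (localRep s e) e.1.target := by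
  have : MemTrivializationAtlas ((antiCanonicalCore n X k).localTriv e) := ⟨⟨e, rfl⟩⟩
  have h := ((antiCanonicalCore n X k).localTriv e).contMDiffOn_section_baseSet_iff
    (IB := 𝓘(ℂ, Fin n → ℂ)) (n := ω) (s := s) |>.1 s.contMDiff.contMDiffOn
  have h2 := h.comp (contMDiffOn_symm_of_mem_maximalAtlas
    (IsManifold.subset_maximalAtlas (I := 𝓘(ℂ, Fin n → ℂ)) (n := ω) e.2))
    (fun z hz => e.1.map_target hz)
  refine (contMDiffOn_iff_contDiffOn.1 h2).congr fun z _ => ?_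
  simp only [Function.comp, VectorBundleCore.localTriv_apply]
  exact (antiCanonicalCore_coordChange _ _ _ _ _).symm

theorem localRep_add {k : ℕ} (s s' : PluriSection n X k) (e : atlas (Fin n → ℂ) X) :
    localRep (s + s') e = localRep s e + localRep s' e := by
  ext z
  exact mul_add _ _ _

theorem localRep_smul {k : ℕ} (c : ℂ) (s : PluriSection n X k) (e : atlas (Fin n → ℂ) X) :
    localRep (c • s) e = c • localRep s e := by
  ext z
  exact mul_left_comm _ _ _

theorem localWeight_eq (w : X → ℝ) (e : atlas (Fin n → ℂ) X) (z : Fin n → ℂ) :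
    localWeight w e z =
      w (e.1.symm z) * ‖transitionDet e (achart (Fin n → ℂ) (e.1.symm z)) (e.1.symm z)‖ ^ 2 := by
  rw [localWeight, antiCanonicalCore_coordChange, pow_one, mul_one]

theorem HermitianMetric.localWeight_pos (h : HermitianMetric n X) (e : atlas (Fin n → ℂ) X)
    {z : Fin n → ℂ} (hz : z ∈ e.1.target) : 0 < localWeight h.weight e z := by
  rw [localWeight_eq]
  have := transitionDet_mul_transitionDet (j := achart (Fin n → ℂ) (e.1.symm z))
    (e.1.map_target hz) (mem_chart_source (Fin n → ℂ) (e.1.symm z))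
  have h1 : transitionDet e (achart (Fin n → ℂ) (e.1.symm z)) (e.1.symm z) ≠ 0 :=
    left_ne_zero_of_mul_eq_one this
  have := h.weight_pos (e.1.symm z)
  positivity

/-- Weight and coefficients refer to the preferred chart, which may jump with the point; in the
product the transition factors cancel. This is what makes pairings continuous on `X`. -/
theorem HermitianMetric.pairing_symm_apply (h : HermitianMetric n X) {k : ℕ}
    (s s' : PluriSection n X k) (e : atlas (Fin n → ℂ) X) {z : Fin n → ℂ} (hz : z ∈ e.1.target) :
    h.pairing s s' (e.1.symm z) = ((localWeight h.weight e z ^ k : ℝ) : ℂ) *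
      (conj (localRep s e z) * localRep s' e z) := by
  have h1 := transitionDet_mul_transitionDet (j := achart (Fin n → ℂ) (e.1.symm z))
    (e.1.map_target hz) (mem_chart_source (Fin n → ℂ) (e.1.symm z))
  rw [localWeight_eq, HermitianMetric.pairing, localRep, localRep]
  set a := transitionDet e (achart (Fin n → ℂ) (e.1.symm z)) (e.1.symm z)
  set b := transitionDet (achart (Fin n → ℂ) (e.1.symm z)) e (e.1.symm z)
  have h2 : (‖a‖ : ℂ) ^ 2 * (conj b * b) = 1 := by
    rw [← Complex.conj_mul', mul_mul_mul_comm, ← map_mul]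
    change a * b = 1 at h1
    simp [h1]
  push_cast [mul_pow]
  calc _ = (h.weight (e.1.symm z) : ℂ) ^ k * (conj (coeff s (e.1.symm z)) *
        coeff s' (e.1.symm z)) * ((‖a‖ : ℂ) ^ 2 * (conj b * b)) ^ k := by rw [h2]; ring
    _ = _ := by simp only [map_mul, map_pow]; ring

theorem HermitianMetric.pairing_self (h : HermitianMetric n X) {k : ℕ}
    (s : PluriSection n X k) (x : X) : h.pairing s s x = (h.normSq s x : ℂ) := by
  simp [HermitianMetric.pairing, HermitianMetric.normSq, Complex.conj_mul']

theorem HermitianMetric.normSq_symm_apply (h : HermitianMetric n X) {k : ℕ}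
    (s : PluriSection n X k) (e : atlas (Fin n → ℂ) X) {z : Fin n → ℂ} (hz : z ∈ e.1.target) :
    h.normSq s (e.1.symm z) = localWeight h.weight e z ^ k * ‖localRep s e z‖ ^ 2 := by
  have := h.pairing_symm_apply s s e hz
  rw [h.pairing_self, Complex.conj_mul'] at this
  exact_mod_cast this

theorem HermitianMetric.continuous_pairing (h : HermitianMetric n X) {k : ℕ}
    (s s' : PluriSection n X k) : Continuous (h.pairing s s') := by
  refine continuous_iff_continuousAt.2 fun x => ?_
  set e := achart (Fin n → ℂ) x
  have hx : x ∈ e.1.source := mem_chart_source _ x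
  have h1 : ContinuousOn (h.pairing s s' ∘ e.1.symm) e.1.target := by
    refine ContinuousOn.congr ?_ fun z hz => h.pairing_symm_apply s s' e hz
    have c1 := (h.smooth e).continuousOn
    have c2 := (contDiffOn_localRep s e).continuousOn
    have c3 := (contDiffOn_localRep s' e).continuousOn
    exact (Complex.continuous_ofReal.comp_continuousOn (c1.pow k)).mul
      ((Complex.continuous_conj.comp_continuousOn c2).mul c3)
  have h2 : ContinuousOn (h.pairing s s') e.1.source := by
    refine (h1.comp e.1.continuousOn fun y hy => e.1.map_source hy).congr fun y hy => ?_
    simp [e.1.left_inv hy]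
  exact h2.continuousAt (e.1.open_source.mem_nhds hx)

theorem HermitianMetric.continuous_normSq (h : HermitianMetric n X) {k : ℕ}
    (s : PluriSection n X k) : Continuous (h.normSq s) := by
  have : h.normSq s = fun x => (h.pairing s s x).re := by
    ext x
    rw [h.pairing_self, Complex.ofReal_re]
  rw [this]
  exact Complex.continuous_re.comp (h.continuous_pairing s s)

theorem HermitianMetric.normSq_nonneg (h : HermitianMetric n X) {k : ℕ}
    (s : PluriSection n X k) (x : X) : 0 ≤ h.normSq s x :=
  mul_nonneg (pow_nonneg (h.weight_pos x).le _) (sq_nonneg _)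

theorem HermitianMetric.normSq_eq_zero_iff (h : HermitianMetric n X) {k : ℕ}
    (s : PluriSection n X k) (x : X) : h.normSq s x = 0 ↔ coeff s x = 0 := by
  simp [HermitianMetric.normSq, (h.weight_pos x).ne']

theorem eq_zero_of_coeff_eq_zero {k : ℕ} {s : PluriSection n X k} (hs : ∀ x, coeff s x = 0) :
    s = 0 := by
  ext x
  exact hs x

end Local

/-! ### Finite-dimensionality of the space of sections

A section all of whose derivatives up to a high order vanish at finitely many suitable points is
zero, by the Schwarz lemma. -/

section FiniteDimensional

open Filter Topology

/-- The Taylor polynomial of degree m vanishes, so only the remainder O(‖w - c‖^(m+1)) is left. -/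
theorem isLittleO_of_iteratedFDeriv_eq_zero {E : Type*} [NormedAddCommGroup E] [NormedSpace ℂ E]
    {f : E → ℂ} {c : E} {m : ℕ} (hf : AnalyticAt ℂ f c)
    (h0 : ∀ j ≤ m, iteratedFDeriv ℂ j f c = 0) :
    f =o[𝓝 c] fun w => ‖w - c‖ ^ m := by
  obtain ⟨p, hp⟩ := hf
  have hsum : ∀ y : E, p.partialSum (m + 1) y = 0 := fun y => by
    refine Finset.sum_eq_zero fun j hj => ?_
    obtain ⟨r, hr⟩ := hp
    have h := hr.factorial_smul y j
    rw [h0 j (Nat.lt_succ_iff.1 (Finset.mem_range.1 hj))] at h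
    simpa [Nat.factorial_ne_zero] using h
  have hO := hp.isBigO_sub_partialSum_pow (m + 1)
  simp only [hsum, sub_zero] at hO
  have ho : (fun y => f (c + y)) =o[𝓝 0] fun y : E => ‖y‖ ^ m := by
    refine hO.trans_isLittleO ?_
    have := (Asymptotics.isLittleO_pow_pow (𝕜 := ℝ) (Nat.lt_succ_self m)).comp_tendsto
      (tendsto_norm_zero (E := E))
    exact this
  have ht : Tendsto (fun w => w - c) (𝓝 c) (𝓝 0) := by
    simpa using (continuous_sub_right c : Continuous fun w : E => w - c).tendsto c
  simpa [Function.comp_def] using ho.comp_tendsto ht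

/-- Schwarz lemma of higher order: on the ball of half the radius, a zero of order at least m + 1
gains the factor (1/2)^(m+1). -/
theorem norm_le_of_iteratedFDeriv_eq_zero {E : Type*} [NormedAddCommGroup E] [NormedSpace ℂ E]
    {f : E → ℂ} {c : E} {m : ℕ} {r M : ℝ} (hr : 0 < r)
    (hd : DifferentiableOn ℂ f (Metric.ball c (2 * r))) (hf : AnalyticAt ℂ f c)
    (h0 : ∀ j ≤ m, iteratedFDeriv ℂ j f c = 0) (hM : ∀ z ∈ Metric.ball c (2 * r), ‖f z‖ ≤ M)
    {z : E} (hz : z ∈ Metric.ball c r) : ‖f z‖ ≤ M * (1 / 2) ^ (m + 1) := by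
  have hc : f c = 0 := by
    have := congrArg (fun A => A fun _ => (0 : E)) (h0 0 (Nat.zero_le m))
    simpa using this
  have h := Complex.dist_le_mul_div_pow_of_mapsTo_ball_of_isLittleO (n := m) (R₂ := M) hd
    (fun w hw => by simpa [hc] using hM w hw)
    (by simpa [hc] using isLittleO_of_iteratedFDeriv_eq_zero hf h0)
    (Metric.ball_subset_ball (by linarith) hz)
  rw [hc, dist_zero_right] at h
  have hM0 : 0 ≤ M := (norm_nonneg _).trans (hM c (Metric.mem_ball_self (by linarith)))
  have hz' : dist z c / (2 * r) ≤ 1 / 2 := by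
    rw [div_le_div_iff₀ (by linarith) two_pos]
    linarith [Metric.mem_ball.1 hz]
  exact h.trans (by gcongr)

variable {n : ℕ} {X : Type*} [TopologicalSpace X] [ChartedSpace (Fin n → ℂ) X]
  [IsManifold 𝓘(ℂ, Fin n → ℂ) ω X]

theorem analyticAt_localRep {k : ℕ} (s : PluriSection n X k) (e : atlas (Fin n → ℂ) X)
    {z : Fin n → ℂ} (hz : z ∈ e.1.target) : AnalyticAt ℂ (localRep s e) z :=
  ((contDiffOn_localRep s e).contDiffAt (e.1.open_target.mem_nhds hz)).analyticAt

/-- The derivatives of order `j` at `x` of sections, in the preferred chart at `x`. -/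
noncomputable def jet (k : ℕ) (x : X) (j : ℕ) :
    PluriSection n X k →ₗ[ℂ] MultilinearMap ℂ (fun _ : Fin j => Fin n → ℂ) ℂ where
  toFun s := (iteratedFDeriv ℂ j (localRep s (achart (Fin n → ℂ) x))
    (chartAt (Fin n → ℂ) x x)).toMultilinearMap
  map_add' s s' := by
    have hx := mem_chart_target (Fin n → ℂ) x
    rw [localRep_add, iteratedFDeriv_add_apply
      (analyticAt_localRep s (achart (Fin n → ℂ) x) hx).contDiffAt
      (analyticAt_localRep s' (achart (Fin n → ℂ) x) hx).contDiffAt]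
    rfl
  map_smul' c s := by
    have hx := mem_chart_target (Fin n → ℂ) x
    rw [localRep_smul, iteratedFDeriv_const_smul_apply
      (analyticAt_localRep s (achart (Fin n → ℂ) x) hx).contDiffAt]
    rfl

/-- `K` is the ratio of the extreme values of the local weight on one closed ball. It depends
neither on `m` nor on the section, so the decay in `m` eventually beats it. -/
theorem HermitianMetric.exists_normSq_le_of_jet_eq_zero (h : HermitianMetric n X) (k : ℕ) (x : X) :
    ∃ U ∈ 𝓝 x, ∃ K : ℝ, ∀ (m : ℕ) (s : PluriSection n X k) (B : ℝ),
      (∀ j ≤ m, jet k x j s = 0) → (∀ y, h.normSq s y ≤ B) →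
        ∀ y ∈ U, h.normSq s y ≤ K * (1 / 4) ^ (m + 1) * B := by
  set e := achart (Fin n → ℂ) x
  set z₀ : Fin n → ℂ := chartAt (Fin n → ℂ) x x
  have hx : x ∈ e.1.source := mem_chart_source _ x
  have hz₀ : z₀ ∈ e.1.target := mem_chart_target _ x
  obtain ⟨R, hR, hRt⟩ := Metric.nhds_basis_closedBall.mem_iff.1 (e.1.open_target.mem_nhds hz₀)
  have hcont : ContinuousOn (fun z => localWeight h.weight e z ^ k) (Metric.closedBall z₀ R) :=
    ((h.smooth e).continuousOn.mono hRt).pow k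
  have hne : (Metric.closedBall z₀ R).Nonempty := ⟨z₀, Metric.mem_closedBall_self hR.le⟩
  obtain ⟨a, ha, hmin⟩ := (isCompact_closedBall z₀ R).exists_isMinOn hne hcont
  obtain ⟨b, hb, hmax⟩ := (isCompact_closedBall z₀ R).exists_isMaxOn hne hcont
  set A := localWeight h.weight e a ^ k
  set C := localWeight h.weight e b ^ k
  have hA : 0 < A := pow_pos (h.localWeight_pos e (hRt ha)) k
  have hC : 0 < C := pow_pos (h.localWeight_pos e (hRt hb)) k
  have hRR : 2 * (R / 2) = R := by ring
  refine ⟨e.1.source ∩ e.1 ⁻¹' Metric.ball z₀ (R / 2),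
    (e.1.isOpen_inter_preimage Metric.isOpen_ball).mem_nhds
      ⟨hx, Metric.mem_ball_self (by linarith)⟩, C / A, ?_⟩
  rintro m s B hs hB y ⟨hy, hyb⟩
  have hB0 : 0 ≤ B := (h.normSq_nonneg s y).trans (hB y)
  have hloc : ∀ z ∈ Metric.ball z₀ (2 * (R / 2)), ‖localRep s e z‖ ≤ √(B / A) := by
    intro z hz
    have hz' := Metric.ball_subset_closedBall (hRR ▸ hz)
    refine Real.le_sqrt_of_sq_le ?_
    rw [le_div_iff₀' hA]
    calc A * ‖localRep s e z‖ ^ 2 ≤ localWeight h.weight e z ^ k * ‖localRep s e z‖ ^ 2 :=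
          mul_le_mul_of_nonneg_right (hmin hz') (sq_nonneg _)
      _ = h.normSq s (e.1.symm z) := (h.normSq_symm_apply s e (hRt hz')).symm
      _ ≤ B := hB _
  have hz : e.1 y ∈ Metric.closedBall z₀ R :=
    Metric.closedBall_subset_closedBall (by linarith) (Metric.ball_subset_closedBall hyb)
  have hdiff : DifferentiableOn ℂ (localRep s e) (Metric.ball z₀ (2 * (R / 2))) :=
    ((contDiffOn_localRep s e).differentiableOn (by simp)).mono
      ((Metric.ball_subset_closedBall.trans (by rw [hRR])).trans hRt)
  have hjet : ∀ j ≤ m, iteratedFDeriv ℂ j (localRep s e) z₀ = 0 := fun j hj =>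
    ContinuousMultilinearMap.toMultilinearMap_injective (hs j hj)
  have hest := norm_le_of_iteratedFDeriv_eq_zero (by linarith) hdiff
    (analyticAt_localRep s e hz₀) hjet hloc hyb
  have hy' : h.normSq s y = localWeight h.weight e (e.1 y) ^ k * ‖localRep s e (e.1 y)‖ ^ 2 := by
    rw [← h.normSq_symm_apply s e (hRt hz), e.1.left_inv hy]
  rw [hy']
  calc _ ≤ C * (√(B / A) * (1 / 2) ^ (m + 1)) ^ 2 := by
        gcongr
        exact hmax hz
    _ = C / A * (1 / 4) ^ (m + 1) * B := by
        rw [mul_pow, Real.sq_sqrt (by positivity), ← pow_mul, mul_comm (m + 1) 2, pow_mul]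
        norm_num
        ring

/-- Finitely many of the neighbourhoods cover `X`. For large m, a section whose m-jets vanish at
their centres has its maximal norm bounded by a factor below 1 times itself, hence is zero. The map
to these jets is thus injective into a finite-dimensional space. -/
theorem HermitianMetric.finiteDimensional_pluriSection [CompactSpace X]
    (h : HermitianMetric n X) (k : ℕ) : FiniteDimensional ℂ (PluriSection n X k) := by
  choose U hU K hK using h.exists_normSq_le_of_jet_eq_zero k
  obtain ⟨t, -, ht⟩ := isCompact_univ.elim_nhds_subcover U fun x _ => hU x
  obtain ⟨K', hK'⟩ := (t.image K).bddAbove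
  have hlim : Tendsto (fun m : ℕ => |K'| * (1 / 4 : ℝ) ^ (m + 1)) atTop (𝓝 (|K'| * 0)) :=
    ((tendsto_pow_atTop_nhds_zero_of_lt_one (by norm_num) (by norm_num)).comp
      (tendsto_add_atTop_nat 1)).const_mul _
  rw [mul_zero] at hlim
  obtain ⟨m, hm⟩ := (hlim.eventually (gt_mem_nhds one_pos)).exists
  let J : PluriSection n X k →ₗ[ℂ]
      (∀ (x : t) (j : Fin (m + 1)), MultilinearMap ℂ (fun _ : Fin j => Fin n → ℂ) ℂ) :=
    LinearMap.pi fun x => LinearMap.pi fun j => jet k x.1 j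
  refine Module.Finite.of_injective J ((injective_iff_map_eq_zero J).2 fun s hs => ?_)
  refine eq_zero_of_coeff_eq_zero fun x => (h.normSq_eq_zero_iff s x).1 ?_
  obtain ⟨y, -, hy⟩ := isCompact_univ.exists_isMaxOn ⟨x, mem_univ x⟩
    (h.continuous_normSq s).continuousOn
  have hmax : ∀ w, h.normSq s w ≤ h.normSq s y := fun w => hy (mem_univ w)
  have hyt := ht (mem_univ y)
  simp only [mem_iUnion, exists_prop] at hyt
  obtain ⟨p, hpt, hyp⟩ := hyt
  have h1 := hK p m s (h.normSq s y)
    (fun j hj => congrFun (congrFun hs ⟨p, hpt⟩) ⟨j, Nat.lt_succ_of_le hj⟩) hmax y hyp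
  have h2 : K p * (1 / 4) ^ (m + 1) ≤ |K'| * (1 / 4) ^ (m + 1) := by
    gcongr
    exact (hK' (Finset.mem_coe.2 (Finset.mem_image_of_mem K hpt))).trans (le_abs_self _)
  have h3 := h.normSq_nonneg s y
  have h4 : h.normSq s y ≤ 0 := by nlinarith
  exact le_antisymm ((hmax x).trans h4) (h.normSq_nonneg s x)

end FiniteDimensional

/-! ### The Monge-Ampère measure is finite and nonzero -/

section Volume

theorem continuousOn_complexHessian {n : ℕ} {u : (Fin n → ℂ) → ℝ} {U : Set (Fin n → ℂ)}
    (hU : IsOpen U) (hu : ContDiffOn ℝ ∞ u U) : ContinuousOn (complexHessian u) U := by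
  have h1 : ContDiffOn ℝ 1 (fderiv ℝ u) U := hu.fderiv_of_isOpen hU (by norm_cast)
  have h2 : ContinuousOn (fderiv ℝ (fderiv ℝ u)) U :=
    (h1.fderiv_of_isOpen hU (m := 0) (by norm_num)).continuousOn
  have h3 : ∀ v w, ContinuousOn (fun z => fderiv ℝ (fderiv ℝ u) z v w) U := fun v w =>
    (h2.clm_apply continuousOn_const).clm_apply continuousOn_const
  refine continuousOn_pi.2 fun j => continuousOn_pi.2 fun l => ?_
  refine continuousOn_const.mul (ContinuousOn.add ?_ (continuousOn_const.mul ?_))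
  · exact Complex.continuous_ofReal.comp_continuousOn ((h3 _ _).add (h3 _ _))
  · exact Complex.continuous_ofReal.comp_continuousOn ((h3 _ _).sub (h3 _ _))

variable {n : ℕ} {X : Type*} [TopologicalSpace X] [ChartedSpace (Fin n → ℂ) X]
  [IsManifold 𝓘(ℂ, Fin n → ℂ) ω X]

theorem HermitianMetric.continuousOn_curvature (h : HermitianMetric n X)
    (e : atlas (Fin n → ℂ) X) : ContinuousOn (h.curvature e) e.1.target :=
  continuousOn_complexHessian e.1.open_target
    (ContDiffOn.log (h.smooth e) fun _ hz => (h.localWeight_pos e hz).ne').neg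

theorem HermitianMetric.IsPositive.det_re_pos {h : HermitianMetric n X} (hpos : h.IsPositive)
    (e : atlas (Fin n → ℂ) X) {z : Fin n → ℂ} (hz : z ∈ e.1.target) :
    0 < (h.curvature e z).det.re :=
  (Complex.pos_iff.1 (hpos e z hz).det_pos).1

variable [CompactSpace X] [T2Space X]

/-- The density of the part of `ω₀ⁿ` that is supported in the preferred chart at `x`. -/
noncomputable def HermitianMetric.chartDensity (h : HermitianMetric n X) (x : X)
    (z : Fin n → ℂ) : ℝ :=
  chartPartition n X x ((chartAt (Fin n → ℂ) x).symm z) *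
    ((n.factorial : ℝ) * (Real.pi⁻¹) ^ n * (h.curvature (achart (Fin n → ℂ) x) z).det.re)

theorem HermitianMetric.continuousOn_chartDensity (h : HermitianMetric n X) (x : X) :
    ContinuousOn (h.chartDensity x) (chartAt (Fin n → ℂ) x).target := by
  have h1 : ContinuousOn (fun z => (h.curvature (achart (Fin n → ℂ) x) z).det.re)
      (chartAt (Fin n → ℂ) x).target :=
    (Complex.continuous_re.comp (continuous_id.matrix_det)).comp_continuousOn
      (h.continuousOn_curvature (achart (Fin n → ℂ) x))
  exact ((chartPartition n X x).continuous.comp_continuousOn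
    (chartAt (Fin n → ℂ) x).continuousOn_symm).mul (continuousOn_const.mul h1)

omit [IsManifold 𝓘(ℂ, Fin n → ℂ) ω X] in
theorem chartPartition_isSubordinate :
    (chartPartition n X).IsSubordinate fun x => (chartAt (Fin n → ℂ) x).source :=
  (exists_chartPartition n X).choose_spec

/-- The curvature may be unbounded towards the edge of the chart, but the density vanishes off the
image of the support of the partition function, a compact subset of the target on which it is
bounded. -/
theorem HermitianMetric.lintegral_chartDensity_ne_top (h : HermitianMetric n X) (x : X) :
    ∫⁻ z in (chartAt (Fin n → ℂ) x).target, ENNReal.ofReal (h.chartDensity x z) ≠ ⊤ := by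
  set e := chartAt (Fin n → ℂ) x
  set K := e '' tsupport (chartPartition n X x)
  have hsub : tsupport (chartPartition n X x) ⊆ e.source := chartPartition_isSubordinate x
  have hK : IsCompact K := (isClosed_tsupport _).isCompact.image_of_continuousOn
    (e.continuousOn.mono hsub)
  have hKt : K ⊆ e.target := by
    rintro _ ⟨y, hy, rfl⟩
    exact e.map_source (hsub hy)
  obtain ⟨C, hC⟩ := hK.bddAbove_image ((h.continuousOn_chartDensity x).mono hKt)
  have hle : ∀ z ∈ e.target, ENNReal.ofReal (h.chartDensity x z) ≤
      K.indicator (fun _ => ENNReal.ofReal C) z := by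
    intro z hz
    by_cases hzK : z ∈ K
    · rw [indicator_of_mem hzK]
      exact ENNReal.ofReal_le_ofReal (hC (mem_image_of_mem _ hzK))
    · have h0 : chartPartition n X x (e.symm z) = 0 := by
        refine image_eq_zero_of_notMem_tsupport fun hmem => hzK ⟨_, hmem, e.right_inv hz⟩
      simp [HermitianMetric.chartDensity, e, h0]
  refine ne_top_of_le_ne_top ?_ (setLIntegral_mono' e.open_target.measurableSet hle)
  refine ne_top_of_le_ne_top ?_ (setLIntegral_le_lintegral _ _)
  rw [lintegral_indicator hK.measurableSet, setLIntegral_const]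
  exact ENNReal.mul_ne_top ENNReal.ofReal_ne_top hK.measure_lt_top.ne

variable [MeasurableSpace X] [BorelSpace X]

omit [BorelSpace X] in
theorem HermitianMetric.isFiniteMeasure_volumeMeasure (h : HermitianMetric n X) :
    IsFiniteMeasure h.volumeMeasure := by
  constructor
  rw [HermitianMetric.volumeMeasure, Measure.sum_apply _ MeasurableSet.univ]
  have hfin := (chartPartition n X).locallyFinite.finite_nonempty_of_compact
  rw [tsum_eq_sum (s := hfin.toFinset)]
  · refine ENNReal.sum_lt_top.2 fun x _ => ?_
    have : IsFiniteMeasure ((volume.restrict (chartAt (Fin n → ℂ) x).target).withDensity fun z =>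
        ENNReal.ofReal (h.chartDensity x z)) :=
      isFiniteMeasure_withDensity (h.lintegral_chartDensity_ne_top x)
    -- No measurability is needed: `Measure.map` is zero by convention for a map that is not a.e.
    -- measurable.
    exact measure_lt_top (Measure.map _ ((volume.restrict _).withDensity fun z =>
        ENNReal.ofReal (h.chartDensity x z))) _
  · intro x hx
    have h0 : ∀ y, chartPartition n X x y = 0 := by
      simpa [Set.not_nonempty_iff_eq_empty, funext_iff] using hx
    simp only [h0, zero_mul, ENNReal.ofReal_zero]
    simp

theorem HermitianMetric.volumeMeasure_ne_zero [Nonempty X] {h : HermitianMetric n X}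
    (hpos : h.IsPositive) : h.volumeMeasure ≠ 0 := by
  obtain ⟨p⟩ := ‹Nonempty X›
  obtain ⟨x, hx⟩ := (chartPartition n X).exists_pos (mem_univ p)
  set e := chartAt (Fin n → ℂ) x
  have hp : p ∈ e.source := chartPartition_isSubordinate x (subset_tsupport _ hx.ne')
  set d := h.chartDensity x (e p) with hd
  have hd0 : 0 < d := by
    have h2 := hpos.det_re_pos (achart (Fin n → ℂ) x) (e.map_source hp)
    rw [hd, HermitianMetric.chartDensity, e.left_inv hp]
    positivity
  -- Where the density exceeds half of its positive value at `e p`: a nonempty open set, hence of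
  -- positive Lebesgue measure.
  set V := e.target ∩ h.chartDensity x ⁻¹' Ioi (d / 2)
  have hV : IsOpen V := (h.continuousOn_chartDensity x).isOpen_inter_preimage e.open_target isOpen_Ioi
  have hVne : V.Nonempty := ⟨e p, e.map_source hp, by simp only [mem_preimage, mem_Ioi]; linarith⟩
  have hint : 0 < ∫⁻ z in e.target, ENNReal.ofReal (h.chartDensity x z) := by
    calc 0 < ENNReal.ofReal (d / 2) * volume V :=
          ENNReal.mul_pos (by simpa using hd0) (hV.measure_pos volume hVne).ne'
      _ = ∫⁻ _ in V, ENNReal.ofReal (d / 2) := (setLIntegral_const _ _).symm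
      _ ≤ ∫⁻ z in V, ENNReal.ofReal (h.chartDensity x z) :=
          setLIntegral_mono' hV.measurableSet fun z hz =>
            ENNReal.ofReal_le_ofReal (le_of_lt hz.2)
      _ ≤ _ := lintegral_mono_set inter_subset_left
  have hmeas : AEMeasurable e.symm ((volume.restrict e.target).withDensity fun z =>
      ENNReal.ofReal (h.chartDensity x z)) :=
    (e.continuousOn_symm.aemeasurable e.open_target.measurableSet).mono_ac
      (withDensity_absolutelyContinuous _ _)
  have hle : (Measure.map e.symm ((volume.restrict e.target).withDensity fun z =>
      ENNReal.ofReal (h.chartDensity x z))) univ ≤ h.volumeMeasure univ :=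
    Measure.le_sum _ x univ
  rw [Measure.map_apply_of_aemeasurable hmeas MeasurableSet.univ, preimage_univ,
    withDensity_apply _ MeasurableSet.univ, Measure.restrict_univ] at hle
  intro h0
  rw [h0] at hle
  exact absurd (hint.trans_le hle) (by simp)

omit [BorelSpace X] in
/-- The measure `μ₀` is finite. -/
theorem isFiniteMeasure_baseMeasure (h : HermitianMetric n X) {ρ : X → ℝ} (hρ : Continuous ρ) :
    IsFiniteMeasure (baseMeasure h ρ) := by
  have := h.isFiniteMeasure_volumeMeasure
  obtain ⟨C, hC⟩ := isCompact_univ.bddAbove_image hρ.continuousOn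
  refine isFiniteMeasure_withDensity (ne_top_of_le_ne_top ?_ (lintegral_mono
    (g := fun _ => ENNReal.ofReal (Real.exp C)) fun x => ENNReal.ofReal_le_ofReal
    (Real.exp_le_exp.2 (hC (mem_image_of_mem ρ (mem_univ x))))))
  rw [lintegral_const]
  exact ENNReal.mul_ne_top ENNReal.ofReal_ne_top (measure_ne_top _ _)

theorem baseMeasure_ne_zero [Nonempty X] {h : HermitianMetric n X} (hpos : h.IsPositive)
    {ρ : X → ℝ} (hρ : Continuous ρ) : baseMeasure h ρ ≠ 0 := by
  intro h0
  have h1 := (withDensity_eq_zero_iff (by fun_prop)).1 h0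
  have h2 : ∀ᵐ _ ∂h.volumeMeasure, False := by
    filter_upwards [h1] with x hx
    exact absurd hx (by simp [Real.exp_pos])
  exact HermitianMetric.volumeMeasure_ne_zero hpos (by simpa using h2)

end Volume

/-! ### Orthonormal bases and weighted inner products -/

section LinearAlgebra

variable {V : Type*} [AddCommGroup V] [Module ℂ V]

theorem core_ext {H H' : InnerProductSpace.Core ℂ V} (h : ∀ u v, H.inner u v = H'.inner u v) :
    H = H' := by
  obtain ⟨⟨⟨i⟩, _, _, _, _⟩, _⟩ := H
  obtain ⟨⟨⟨i'⟩, _, _, _, _⟩, _⟩ := H'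
  obtain rfl : i = i' := by
    ext u v
    exact h u v
  rfl

theorem exists_orthonormal_basis [FiniteDimensional ℂ V] (H : InnerProductSpace.Core ℂ V) :
    ∃ s : Module.Basis (Fin (Module.finrank ℂ V)) ℂ V,
      ∀ i j, H.inner (s i) (s j) = if i = j then 1 else 0 := by
  let _ : NormedAddCommGroup V := H.toNormedAddCommGroup
  let _ : InnerProductSpace ℂ V := InnerProductSpace.ofCore H.toCore
  refine ⟨(stdOrthonormalBasis ℂ V).toBasis, fun i j => ?_⟩
  simpa using orthonormal_iff_ite.1 (stdOrthonormalBasis ℂ V).orthonormal i j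

theorem exists_basis_of_orthonormal [FiniteDimensional ℂ V] (H : InnerProductSpace.Core ℂ V)
    {s : Fin (Module.finrank ℂ V) → V}
    (hs : ∀ i j, H.inner (s i) (s j) = if i = j then 1 else 0) :
    ∃ b : Module.Basis (Fin (Module.finrank ℂ V)) ℂ V, ⇑b = s := by
  let _ : NormedAddCommGroup V := H.toNormedAddCommGroup
  let _ : InnerProductSpace ℂ V := InnerProductSpace.ofCore H.toCore
  have ho : Orthonormal ℂ s := orthonormal_iff_ite.2 hs
  have hsp : Submodule.span ℂ (range s) = ⊤ :=
    ho.linearIndependent.span_eq_top_of_card_eq_finrank' (by simp)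
  exact ⟨Module.Basis.mk ho.linearIndependent hsp.ge, Module.Basis.coe_mk _ _⟩

/-- Both sums are the squared norm of the Riesz representative of `φ`. For evaluation at a point,
this makes the Bergman function independent of the basis chosen by `onb`. -/
theorem sum_norm_sq_eq_of_orthonormal [FiniteDimensional ℂ V] (H : InnerProductSpace.Core ℂ V)
    {s s' : Fin (Module.finrank ℂ V) → V}
    (hs : ∀ i j, H.inner (s i) (s j) = if i = j then 1 else 0)
    (hs' : ∀ i j, H.inner (s' i) (s' j) = if i = j then 1 else 0) (φ : V →ₗ[ℂ] ℂ) :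
    ∑ i, ‖φ (s i)‖ ^ 2 = ∑ i, ‖φ (s' i)‖ ^ 2 := by
  let _ : NormedAddCommGroup V := H.toNormedAddCommGroup
  let _ : InnerProductSpace ℂ V := InnerProductSpace.ofCore H.toCore
  have : CompleteSpace V := FiniteDimensional.complete ℂ V
  obtain ⟨y, hy⟩ := (InnerProductSpace.toDual ℂ V).surjective φ.toContinuousLinearMap
  have hφ : ∀ v, φ v = inner ℂ y v := fun v => by
    rw [← InnerProductSpace.toDual_apply_apply, hy]
    rfl
  have key : ∀ t : Fin (Module.finrank ℂ V) → V,
      (∀ i j, H.inner (t i) (t j) = if i = j then 1 else 0) → ∑ i, ‖φ (t i)‖ ^ 2 = ‖y‖ ^ 2 := by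
    intro t ht
    have ho : Orthonormal ℂ t := orthonormal_iff_ite.2 ht
    have hsp : Submodule.span ℂ (range t) = ⊤ :=
      ho.linearIndependent.span_eq_top_of_card_eq_finrank' (by simp)
    simpa [hφ] using (OrthonormalBasis.mk ho hsp.ge).sum_sq_norm_inner_left y
  rw [key s hs, key s' hs']

variable {ι : Type*} [Fintype ι]

/-- The inner product for which `s` is orthogonal and `s i` has squared length `w i`. -/
@[reducible] noncomputable def weightedCore (s : Module.Basis ι ℂ V) (w : ι → ℝ) (hw : ∀ i, 0 < w i) :
    InnerProductSpace.Core ℂ V where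
  inner u v := ∑ i, (w i : ℂ) * (conj (s.repr u i) * s.repr v i)
  conj_inner_symm u v := by
    simp [mul_comm]
  re_inner_nonneg u := by
    simp only [Complex.conj_mul', map_sum]
    refine Finset.sum_nonneg fun i _ => ?_
    have h1 : 0 ≤ w i * ‖s.repr u i‖ ^ 2 := mul_nonneg (hw i).le (sq_nonneg _)
    exact_mod_cast h1
  add_left u v z := by
    simp [add_mul, mul_add, Finset.sum_add_distrib]
  smul_left u v r := by
    simp only [map_smul, Finsupp.smul_apply, smul_eq_mul, map_mul, Finset.mul_sum]
    exact Finset.sum_congr rfl fun i _ => by ring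
  definite u hu := by
    have h1 : ∑ i, w i * ‖s.repr u i‖ ^ 2 = 0 := by
      simp only [Complex.conj_mul'] at hu
      exact_mod_cast hu
    have h2 := (Finset.sum_eq_zero_iff_of_nonneg fun i _ =>
      mul_nonneg (hw i).le (sq_nonneg _)).1 h1
    refine s.repr.map_eq_zero_iff.1 (Finsupp.ext fun i => ?_)
    have h3 := h2 i (Finset.mem_univ i)
    simpa [(hw i).ne'] using h3

theorem weightedCore_inner (s : Module.Basis ι ℂ V) (w : ι → ℝ) (hw : ∀ i, 0 < w i) (u v : V) :
    (weightedCore s w hw).inner u v = ∑ i, (w i : ℂ) * (conj (s.repr u i) * s.repr v i) :=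
  rfl

theorem weightedCore_inner_basis [DecidableEq ι] (s : Module.Basis ι ℂ V) (w : ι → ℝ)
    (hw : ∀ i, 0 < w i) (i j : ι) :
    (weightedCore s w hw).inner (s i) (s j) = if i = j then (w i : ℂ) else 0 := by
  rw [weightedCore_inner, Finset.sum_eq_single i]
  · simp [Finsupp.single_apply, eq_comm]
  · intro l _ hl
    simp [Finsupp.single_apply, hl.symm]
  · simp

theorem inner_eq_sum_of_orthonormal [DecidableEq ι] (H : InnerProductSpace.Core ℂ V)
    (s : Module.Basis ι ℂ V) (hs : ∀ i j, H.inner (s i) (s j) = if i = j then 1 else 0) (u v : V) :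
    H.inner u v = ∑ i, conj (s.repr u i) * s.repr v i := by
  let _ : NormedAddCommGroup V := H.toNormedAddCommGroup
  let _ : InnerProductSpace ℂ V := InnerProductSpace.ofCore H.toCore
  have ho : Orthonormal ℂ s := orthonormal_iff_ite.2 hs
  have h := ho.inner_sum (s.repr u) (s.repr v) Finset.univ
  rw [s.sum_repr, s.sum_repr] at h
  exact h

end LinearAlgebra

/-! ### Orthonormal bases of sections, and geodesics with prescribed weights -/

section Sections

variable {n : ℕ} {X : Type*} [TopologicalSpace X] [ChartedSpace (Fin n → ℂ) X]
  [IsManifold 𝓘(ℂ, Fin n → ℂ) ω X] {k : ℕ}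

/-- The coefficient at `x` as a linear functional. -/
noncomputable def coeffLinear (x : X) : PluriSection n X k →ₗ[ℂ] ℂ where
  toFun s := coeff s x
  map_add' _ _ := rfl
  map_smul' _ _ := rfl

/-- Finite dimension ensures that the junk value 0 of `onb` is not taken. -/
theorem isONB_onb [FiniteDimensional ℂ (PluriSection n X k)] (H : HermForm n X k) :
    IsONB H (onb H) := by
  have h : ∃ s : Module.Basis (Fin (sectionDim n X k)) ℂ (PluriSection n X k), IsONB H s :=
    exists_orthonormal_basis H
  rw [onb, dif_pos h]
  exact h.choose_spec

theorem HermitianMetric.sum_normSq_onb [FiniteDimensional ℂ (PluriSection n X k)]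
    (h : HermitianMetric n X) {H : HermForm n X k}
    {s : Fin (sectionDim n X k) → PluriSection n X k} (hs : IsONB H s) (x : X) :
    ∑ i, h.normSq (onb H i) x = ∑ i, h.normSq (s i) x := by
  have := sum_norm_sq_eq_of_orthonormal H (isONB_onb H) hs (coeffLinear x)
  simp only [HermitianMetric.normSq, ← Finset.mul_sum]
  exact congrArg _ this

theorem HermitianMetric.normSq_smul (h : HermitianMetric n X) (c : ℂ) (s : PluriSection n X k)
    (x : X) : h.normSq (c • s) x = ‖c‖ ^ 2 * h.normSq s x := by
  have : coeff (c • s) x = c * coeff s x := rfl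
  simp only [HermitianMetric.normSq, this, norm_mul, mul_pow]
  ring

/-- Every family of weights with respect to an orthonormal basis comes from a geodesic. -/
theorem exists_isGeodesic {H₀ : HermForm n X k}
    (s : Module.Basis (Fin (sectionDim n X k)) ℂ (PluriSection n X k)) (hs : IsONB H₀ s)
    (lam : Fin (sectionDim n X k) → ℝ) :
    ∃ H : ℝ → HermForm n X k, IsGeodesic H ∧ H 0 = H₀ ∧ HasWeights H s lam := by
  -- If e^{λ_i t/2} s_i has length one, then s_i has squared length e^{-λ_i t}; so H⁻¹H' is the
  -- constant operator diag(-λ_i).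
  refine ⟨fun t => weightedCore s (fun i => Real.exp (-lam i * t)) fun i => Real.exp_pos _,
    ⟨fun _ => s.constr ℂ fun i => ((-lam i : ℝ) : ℂ) • s i, ?_, ?_⟩, ?_, ?_⟩
  rotate_left 2
  · refine core_ext fun u v => ?_
    rw [weightedCore_inner, inner_eq_sum_of_orthonormal H₀ s hs]
    simp
  · intro t i j
    have h1 := weightedCore_inner_basis s (fun i => Real.exp (-lam i * t))
      (fun i => Real.exp_pos _) i j
    rw [weightedCore_inner] at h1 ⊢
    simp only [map_smul, Finsupp.smul_apply, smul_eq_mul, map_mul, Complex.conj_ofReal]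
    calc _ = (Real.exp (lam i / 2 * t) : ℂ) * (Real.exp (lam j / 2 * t) : ℂ) *
          (if i = j then (Real.exp (-lam i * t) : ℂ) else 0) := by
          rw [← h1, Finset.mul_sum]
          exact Finset.sum_congr rfl fun l _ => by ring
      _ = _ := by
          split_ifs with hij
          · subst hij
            norm_cast
            rw [← Real.exp_add, ← Real.exp_add]
            ring_nf
            simp
          · simp
  all_goals
    intro t u v
    have hA : ∀ w i, s.repr (s.constr ℂ (fun i => ((-lam i : ℝ) : ℂ) • s i) w) i =
        ((-lam i : ℝ) : ℂ) * s.repr w i := by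
      intro w i
      rw [s.constr_apply_fintype ℂ, map_sum, Finsupp.finsetSum_apply, Finset.sum_eq_single i]
      · simp only [map_smul, Finsupp.smul_apply, smul_eq_mul, s.equivFun_apply, s.repr_self,
          Finsupp.single_eq_same, mul_one, mul_comm]
      · intro j _ hj
        simp only [map_smul, Finsupp.smul_apply, smul_eq_mul, s.repr_self,
          Finsupp.single_eq_of_ne' hj, mul_zero]
      · simp
    have hd : ∀ i, HasDerivAt (fun τ : ℝ => ((Real.exp (-lam i * τ) : ℝ) : ℂ))
        ((-lam i : ℝ) * (Real.exp (-lam i * t) : ℝ) : ℂ) t := by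
      intro i
      have h1 : HasDerivAt (fun τ : ℝ => Real.exp (-lam i * τ))
          (-lam i * Real.exp (-lam i * t)) t := by
        simpa [mul_comm] using ((hasDerivAt_id t).const_mul (-lam i)).exp
      simpa using h1.ofReal_comp
    simp only [weightedCore_inner, hA]
    refine HasDerivAt.fun_sum fun i _ => ?_
    exact ((hd i).mul_const _).congr_deriv (by ring)

end Sections

/-! ### The derivative of the functional `L` along geodesics -/

section LogSumExp

theorem exp_mul_sum_le {ι : Type*} [Fintype ι] (lam G : ι → ℝ) (hG : ∀ i, 0 ≤ G i) (t : ℝ) :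
    Real.exp (-((∑ i, |lam i|) * |t|)) * ∑ i, G i ≤ ∑ i, Real.exp (lam i * t) * G i := by
  rw [Finset.mul_sum]
  refine Finset.sum_le_sum fun i _ => mul_le_mul_of_nonneg_right (Real.exp_le_exp.2 ?_) (hG i)
  have h1 : |lam i| ≤ ∑ j, |lam j| :=
    Finset.single_le_sum (f := fun j => |lam j|) (fun j _ => abs_nonneg _) (Finset.mem_univ i)
  have h2 : |lam i * t| ≤ (∑ j, |lam j|) * |t| := by
    rw [abs_mul]
    gcongr
  linarith [neg_abs_le (lam i * t)]

variable {X : Type*} [TopologicalSpace X] [CompactSpace X] [MeasurableSpace X] [BorelSpace X]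

theorem integrable_of_continuous {E : Type*} [NormedAddCommGroup E] {μ : Measure X}
    [IsFiniteMeasure μ] {f : X → E} (hf : Continuous f) : Integrable f μ :=
  hf.integrable_of_hasCompactSupport (HasCompactSupport.of_compactSpace f)

/-- Domination on |t| ≤ 1, with Λ = ∑ |λ_i|: the t-derivative of the logarithm is a weighted mean of
the λ_i, hence at most Λ in absolute value, and the logarithm lies at most Λ below its value at t =
0. The resulting bound is continuous on a compact space. -/
theorem hasDerivAt_integral_exp_neg_log_sum_exp {ι : Type*} [Fintype ι] {μ : Measure X}
    [IsFiniteMeasure μ] {G : ι → X → ℝ} (hG : ∀ i, Continuous (G i)) (hG0 : ∀ i x, 0 ≤ G i x)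
    (hS : ∀ x, 0 < ∑ i, G i x) {c κ : ℝ} (hc : 0 < c) (hκ : 0 ≤ κ) (lam : ι → ℝ) :
    HasDerivAt (fun t => ∫ x, Real.exp (-(κ * Real.log (c * ∑ i, Real.exp (lam i * t) * G i x))) ∂μ)
      (∫ x, Real.exp (-(κ * Real.log (c * ∑ i, G i x))) *
        -(κ * ((∑ i, lam i * G i x) / ∑ i, G i x)) ∂μ) 0 := by
  set Λ := ∑ i, |lam i|
  have hΛ : 0 ≤ Λ := Finset.sum_nonneg fun i _ => abs_nonneg _
  have hT : ∀ t x, 0 < ∑ i, Real.exp (lam i * t) * G i x := fun t x =>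
    (mul_pos (Real.exp_pos _) (hS x)).trans_le (exp_mul_sum_le lam (G · x) (hG0 · x) t)
  have hTc : ∀ t, Continuous fun x => ∑ i, Real.exp (lam i * t) * G i x := fun t => by fun_prop
  have hFc : ∀ t, Continuous fun x =>
      Real.exp (-(κ * Real.log (c * ∑ i, Real.exp (lam i * t) * G i x))) := fun t =>
    Real.continuous_exp.comp (continuous_const.mul
      ((continuous_const.mul (hTc t)).log fun x => (mul_pos hc (hT t x)).ne')).neg
  have hF'c : Continuous fun x =>
      Real.exp (-(κ * Real.log (c * ∑ i, Real.exp (lam i * 0) * G i x))) *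
      -(κ * ((∑ i, lam i * (Real.exp (lam i * 0) * G i x)) /
        ∑ i, Real.exp (lam i * 0) * G i x)) :=
    (hFc 0).mul (continuous_const.mul
      (Continuous.div (by fun_prop) (hTc 0) fun x => (hT 0 x).ne')).neg
  have key := hasDerivAt_integral_of_dominated_loc_of_deriv_le (𝕜 := ℝ) (μ := μ) (x₀ := 0)
    (F := fun t x => Real.exp (-(κ * Real.log (c * ∑ i, Real.exp (lam i * t) * G i x))))
    (F' := fun t x => Real.exp (-(κ * Real.log (c * ∑ i, Real.exp (lam i * t) * G i x))) *
      -(κ * ((∑ i, lam i * (Real.exp (lam i * t) * G i x)) /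
        ∑ i, Real.exp (lam i * t) * G i x)))
    (bound := fun x => Real.exp (κ * Λ) *
      Real.exp (-(κ * Real.log (c * ∑ i, Real.exp (lam i * 0) * G i x))) * (κ * Λ))
    (s := Metric.closedBall 0 1) (Metric.closedBall_mem_nhds 0 one_pos)
    (Filter.Eventually.of_forall fun t => (integrable_of_continuous (hFc t)).aestronglyMeasurable)
    (integrable_of_continuous (hFc 0))
    (integrable_of_continuous hF'c).aestronglyMeasurable
    (ae_of_all _ ?_)
    (integrable_of_continuous ((continuous_const.mul (hFc 0)).mul continuous_const))
    (ae_of_all _ ?_)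
  · simpa using key.2
  · intro x t ht
    have ht1 : |t| ≤ 1 := by simpa using ht
    rw [norm_mul, Real.norm_eq_abs, abs_of_pos (Real.exp_pos _), Real.norm_eq_abs, abs_neg,
      abs_mul, abs_of_nonneg hκ, abs_div, abs_of_pos (hT t x), ← Real.exp_add]
    have h1 : (|∑ i, lam i * (Real.exp (lam i * t) * G i x)| /
        ∑ i, Real.exp (lam i * t) * G i x) ≤ Λ := by
      rw [div_le_iff₀ (hT t x), Finset.mul_sum]
      refine (Finset.abs_sum_le_sum_abs _ _).trans (Finset.sum_le_sum fun i _ => ?_)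
      have h0 : 0 ≤ Real.exp (lam i * t) * G i x := mul_nonneg (Real.exp_pos _).le (hG0 i x)
      rw [abs_mul, abs_of_nonneg h0]
      exact mul_le_mul_of_nonneg_right (Finset.single_le_sum (f := fun j => |lam j|)
        (fun j _ => abs_nonneg _) (Finset.mem_univ i)) h0
    have h2 : Real.log (c * ∑ i, Real.exp (lam i * 0) * G i x) - Λ ≤
        Real.log (c * ∑ i, Real.exp (lam i * t) * G i x) := by
      have h3 := exp_mul_sum_le lam (G · x) (hG0 · x) t
      have h4 : Real.exp (-Λ) * ∑ i, G i x ≤ ∑ i, Real.exp (lam i * t) * G i x := by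
        refine le_trans (mul_le_mul_of_nonneg_right (Real.exp_le_exp.2 ?_) (hS x).le) h3
        nlinarith
      have h5 := Real.log_le_log (mul_pos hc (mul_pos (Real.exp_pos _) (hS x)))
        (mul_le_mul_of_nonneg_left h4 hc.le)
      rw [mul_left_comm, Real.log_mul (Real.exp_pos _).ne' (mul_pos hc (hS x)).ne',
        Real.log_exp] at h5
      simp only [mul_zero, Real.exp_zero, one_mul]
      linarith
    refine mul_le_mul (Real.exp_le_exp.2 ?_) (mul_le_mul_of_nonneg_left h1 hκ)
      (mul_nonneg hκ (div_nonneg (abs_nonneg _) (hT t x).le)) (Real.exp_pos _).le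
    linarith [mul_le_mul_of_nonneg_left h2 hκ]
  · intro x t _
    have h1 : HasDerivAt (fun t => ∑ i, Real.exp (lam i * t) * G i x)
        (∑ i, lam i * (Real.exp (lam i * t) * G i x)) t := by
      refine HasDerivAt.fun_sum fun i _ => ?_
      have h2 : HasDerivAt (fun τ : ℝ => Real.exp (lam i * τ)) (Real.exp (lam i * t) * lam i) t := by
        simpa using ((hasDerivAt_id t).const_mul (lam i)).exp
      exact (h2.mul_const _).congr_deriv (by ring)
    have h3 := (((h1.const_mul c).log (mul_pos hc (hT t x)).ne').const_mul κ).neg.exp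
    refine h3.congr_deriv ?_
    rw [mul_div_mul_left _ _ hc.ne']
    rfl

end LogSumExp

/-! ### Positivity of the Bergman function -/

section Bergman

variable {n : ℕ} {X : Type*} [TopologicalSpace X] [ChartedSpace (Fin n → ℂ) X]
  [IsManifold 𝓘(ℂ, Fin n → ℂ) ω X] {k : ℕ}

/-- The Bergman function `∑ |s_i|²` of an inner product `H`. -/
noncomputable def HermitianMetric.bergman (h : HermitianMetric n X) (H : HermForm n X k) (x : X) :
    ℝ :=
  ∑ i, h.normSq (onb H i) x

theorem HermitianMetric.continuous_bergman (h : HermitianMetric n X) (H : HermForm n X k) :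
    Continuous (h.bergman H) :=
  continuous_finsetSum _ fun i _ => h.continuous_normSq (onb H i)

/-- If every basis section vanished at x, so would every section, against global generation. -/
theorem HermitianMetric.bergman_pos [FiniteDimensional ℂ (PluriSection n X k)]
    (h : HermitianMetric n X) (H : HermForm n X k)
    (hgen : ∀ x : X, ∃ s : PluriSection n X k, coeff s x ≠ 0) (x : X) : 0 < h.bergman H x := by
  have hnn : ∀ i ∈ Finset.univ, 0 ≤ h.normSq (onb H i) x := fun i _ => h.normSq_nonneg _ x
  refine lt_of_le_of_ne (Finset.sum_nonneg hnn) fun h0 => ?_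
  have h1 := (Finset.sum_eq_zero_iff_of_nonneg hnn).1 h0.symm
  obtain ⟨b, hb⟩ := exists_basis_of_orthonormal H (isONB_onb H)
  obtain ⟨s, hs⟩ := hgen x
  have h2 : coeffLinear (k := k) x = 0 := b.ext fun i => by
    rw [hb]
    exact (h.normSq_eq_zero_iff _ x).1 (h1 i (Finset.mem_univ i))
  exact hs (LinearMap.congr_fun h2 s)

theorem sectionDim_pos [FiniteDimensional ℂ (PluriSection n X k)] [Nonempty X]
    (hgen : ∀ x : X, ∃ s : PluriSection n X k, coeff s x ≠ 0) : 0 < sectionDim n X k := by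
  obtain ⟨s, hs⟩ := hgen (Classical.arbitrary X)
  have : Nontrivial (PluriSection n X k) := ⟨s, 0, fun h => hs (by rw [h]; rfl)⟩
  exact Module.finrank_pos

theorem HermitianMetric.continuous_fubiniStudy [FiniteDimensional ℂ (PluriSection n X k)]
    [Nonempty X] (h : HermitianMetric n X) (H : HermForm n X k)
    (hgen : ∀ x : X, ∃ s : PluriSection n X k, coeff s x ≠ 0) :
    Continuous (fubiniStudy h H) := by
  have hN : (0 : ℝ) < sectionDim n X k := Nat.cast_pos.2 (sectionDim_pos hgen)
  exact continuous_const.mul ((continuous_const.mul (h.continuous_bergman H)).log fun x =>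
    (mul_pos (inv_pos.2 hN) (h.bergman_pos H hgen x)).ne')

end Bergman

/-! ### The canonical probability measure and the slope of `L` -/

section Functional

variable {n : ℕ} {X : Type*} [TopologicalSpace X] [CompactSpace X] [T2Space X]
  [ChartedSpace (Fin n → ℂ) X] [IsManifold 𝓘(ℂ, Fin n → ℂ) ω X] [MeasurableSpace X] [BorelSpace X]

theorem integral_canonicalMeasure {h : HermitianMetric n X} {ρ φ : X → ℝ}
    (hρ : Continuous ρ) (hφ : Continuous φ) {E : Type*} [NormedAddCommGroup E] [NormedSpace ℝ E]
    (g : X → E) :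
    ∫ x, g x ∂canonicalMeasure h ρ φ =
      (∫ x, Real.exp (-φ x) ∂baseMeasure h ρ)⁻¹ • ∫ x, Real.exp (-φ x) • g x ∂baseMeasure h ρ := by
  have := isFiniteMeasure_baseMeasure h hρ
  have hint : Integrable (fun x => Real.exp (-φ x)) (baseMeasure h ρ) :=
    integrable_of_continuous (by fun_prop)
  rw [canonicalMeasure, integral_smul_measure,
    ← ofReal_integral_eq_lintegral_ofReal hint (ae_of_all _ fun x => (Real.exp_pos _).le),
    integral_withDensity_eq_integral_toReal_smul (by fun_prop)
      (ae_of_all _ fun x => ENNReal.ofReal_lt_top)]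
  simp only [ENNReal.toReal_inv, ENNReal.toReal_ofReal (Real.exp_pos _).le]
  rw [ENNReal.toReal_ofReal (integral_nonneg fun x => (Real.exp_pos _).le)]

theorem isProbabilityMeasure_canonicalMeasure [Nonempty X] {h : HermitianMetric n X}
    (hpos : h.IsPositive) {ρ φ : X → ℝ} (hρ : Continuous ρ) (hφ : Continuous φ) :
    IsProbabilityMeasure (canonicalMeasure h ρ φ) := by
  have := isFiniteMeasure_baseMeasure h hρ
  have : NeZero (baseMeasure h ρ) := ⟨baseMeasure_ne_zero hpos hρ⟩
  have hint : Integrable (fun x => Real.exp (-φ x)) (baseMeasure h ρ) :=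
    integrable_of_continuous (by fun_prop)
  have hI := integral_exp_pos hint
  constructor
  rw [canonicalMeasure, Measure.smul_apply, withDensity_apply _ MeasurableSet.univ,
    Measure.restrict_univ, smul_eq_mul,
    ← ofReal_integral_eq_lintegral_ofReal hint (ae_of_all _ fun x => (Real.exp_pos _).le)]
  exact ENNReal.inv_mul_cancel (by simpa using hI) ENNReal.ofReal_ne_top

variable {k : ℕ}

/-- The derivative of -log ∫ e^{-f_t} is the mean of f_t' for the canonical measure, and at t = 0
one has f_t' = k⁻¹ ∑ λ_i |s_i|² / ∑ |s_j|². The factor V⁻¹ drops out of the logarithmic derivative.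
-/
theorem hasDerivAt_lFunctional_fubiniStudy [FiniteDimensional ℂ (PluriSection n X k)] [Nonempty X]
    {h : HermitianMetric n X} (hpos : h.IsPositive) {ρ : X → ℝ} (hρ : Continuous ρ)
    (hgen : ∀ x : X, ∃ s : PluriSection n X k, coeff s x ≠ 0)
    {H : ℝ → HermForm n X k}
    {s : Module.Basis (Fin (sectionDim n X k)) ℂ (PluriSection n X k)}
    {lam : Fin (sectionDim n X k) → ℝ} (hw : HasWeights H s lam) :
    HasDerivAt (fun t => lFunctional h ρ (fubiniStudy h (H t)))
      ((k : ℝ)⁻¹ * ∑ i, lam i * ∫ x, h.normSq (s i) x / h.bergman (H 0) x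
        ∂canonicalMeasure h ρ (fubiniStudy h (H 0))) 0 := by
  have := isFiniteMeasure_baseMeasure h hρ
  have : NeZero (baseMeasure h ρ) := ⟨baseMeasure_ne_zero hpos hρ⟩
  have := h.isFiniteMeasure_volumeMeasure
  have hN : (0 : ℝ) < sectionDim n X k := Nat.cast_pos.2 (sectionDim_pos hgen)
  have hfs := h.continuous_fubiniStudy (H 0) hgen
  have hsum : ∀ t x, ∑ i, h.normSq (onb (H t) i) x =
      ∑ i, Real.exp (lam i * t) * h.normSq (s i) x := by
    intro t x
    rw [h.sum_normSq_onb (hw t) x]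
    refine Finset.sum_congr rfl fun i _ => ?_
    rw [h.normSq_smul, Complex.norm_real, Real.norm_eq_abs, abs_of_pos (Real.exp_pos _), sq,
      ← Real.exp_add]
    ring_nf
  have hsum0 : ∀ x, h.bergman (H 0) x = ∑ i, h.normSq (s i) x := fun x => by
    simpa [HermitianMetric.bergman] using hsum 0 x
  have hS : ∀ x, 0 < ∑ i, h.normSq (s i) x := fun x =>
    (hsum0 x) ▸ h.bergman_pos (H 0) hgen x
  have hder := hasDerivAt_integral_exp_neg_log_sum_exp (μ := baseMeasure h ρ)
    (fun i => h.continuous_normSq (s i)) (fun i x => h.normSq_nonneg (s i) x) hS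
    (inv_pos.2 hN) (inv_nonneg.2 (Nat.cast_nonneg k)) lam
  simp only [← hsum0] at hder
  simp only [← hsum] at hder
  have hI : 0 < ∫ x, Real.exp (-fubiniStudy h (H 0) x) ∂baseMeasure h ρ :=
    integral_exp_pos (integrable_of_continuous (by fun_prop))
  have hV : 0 < (h.volumeMeasure.real univ)⁻¹ := inv_pos.2 <|
    ENNReal.toReal_pos (Measure.measure_univ_ne_zero.2 (HermitianMetric.volumeMeasure_ne_zero hpos))
      (measure_ne_top _ _)
  have hL := ((hder.const_mul (h.volumeMeasure.real univ)⁻¹).log (mul_pos hV hI).ne').neg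
  refine hL.congr_deriv ?_
  rw [mul_div_mul_left _ _ hV.ne']
  have hint : ∀ i, Integrable (fun x => Real.exp (-fubiniStudy h (H 0) x) *
      (h.normSq (s i) x / h.bergman (H 0) x)) (baseMeasure h ρ) := fun i =>
    integrable_of_continuous ((by fun_prop : Continuous _).mul
      ((h.continuous_normSq (s i)).div (h.continuous_bergman _) fun x =>
        (h.bergman_pos (H 0) hgen x).ne'))
  simp only [integral_canonicalMeasure hρ hfs, smul_eq_mul]
  have hnum : ∫ x, Real.exp (-fubiniStudy h (H 0) x) *
      -((k : ℝ)⁻¹ * ((∑ i, lam i * h.normSq (s i) x) / h.bergman (H 0) x)) ∂baseMeasure h ρ =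
      -((k : ℝ)⁻¹ * ∑ i, lam i * ∫ x, Real.exp (-fubiniStudy h (H 0) x) *
        (h.normSq (s i) x / h.bergman (H 0) x) ∂baseMeasure h ρ) := by
    simp only [← integral_const_mul]
    rw [← integral_finsetSum _ fun i _ => (hint i).const_mul _, ← integral_const_mul,
      ← integral_neg]
    refine integral_congr_ae (ae_of_all _ fun x => ?_)
    simp only [Finset.sum_div, Finset.mul_sum]
    rw [← Finset.sum_neg_distrib, ← Finset.sum_neg_distrib, Finset.mul_sum]
    exact Finset.sum_congr rfl fun i _ => by ring
  change -((∫ x, Real.exp (-fubiniStudy h (H 0) x) *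
      -((k : ℝ)⁻¹ * ((∑ i, lam i * h.normSq (s i) x) / h.bergman (H 0) x)) ∂baseMeasure h ρ) /
      ∫ x, Real.exp (-fubiniStudy h (H 0) x) ∂baseMeasure h ρ) = _
  rw [hnum, neg_div, neg_neg, mul_div_assoc, Finset.sum_div]
  congr 1
  exact Finset.sum_congr rfl fun i _ => by ring

end Functional

/-! ### Diagonalization of Hermitian forms -/

section Diagonalization

/-- Both factors are diagonal in the eigenbasis of `M`. -/
theorem trace_mul_cfc {ι : Type*} [Fintype ι] [DecidableEq ι] {M : Matrix ι ι ℂ}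
    (hM : M.IsHermitian) (f : ℝ → ℝ) :
    (M * cfc f M).trace = ((∑ i, hM.eigenvalues i * f (hM.eigenvalues i) : ℝ) : ℂ) := by
  have h : M * cfc f M = Unitary.conjStarAlgAut ℂ _ hM.eigenvectorUnitary
      (Matrix.diagonal fun i => ((hM.eigenvalues i * f (hM.eigenvalues i) : ℝ) : ℂ)) := by
    have h1 : (Matrix.diagonal fun i => ((hM.eigenvalues i * f (hM.eigenvalues i) : ℝ) : ℂ)) =
        Matrix.diagonal (RCLike.ofReal ∘ hM.eigenvalues) *
          Matrix.diagonal (RCLike.ofReal ∘ f ∘ hM.eigenvalues) := by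
      rw [Matrix.diagonal_mul_diagonal]
      simp
    rw [h1, map_mul, ← hM.spectral_theorem, hM.cfc_eq]
    rfl
  rw [h, Unitary.conjStarAlgAut_apply, Matrix.trace_mul_cycle]
  simp [Matrix.trace_diagonal]

theorem sesquilinear_apply_sum {ι V : Type*} [Fintype ι] [AddCommGroup V] [Module ℂ V]
    (B : V →ₗ⋆[ℂ] V →ₗ[ℂ] ℂ) (s : ι → V) (U : Matrix ι ι ℂ) (a c : ι) :
    B (∑ j, U j a • s j) (∑ j, U j c • s j) =
      (star U * (Matrix.of fun i j => B (s i) (s j)) * U) a c := by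
  simp only [map_sum, LinearMap.sum_apply, map_smulₛₗ, LinearMap.smul_apply, Matrix.mul_apply,
    Matrix.star_apply, Matrix.of_apply, smul_eq_mul, Finset.sum_mul, Finset.mul_sum, RingHom.id_apply,
    Complex.star_def]
  exact Finset.sum_congr rfl fun i _ => Finset.sum_congr rfl fun j _ => by ring

/-- An inner product as a sesquilinear map. -/
def coreSesquilinear {V : Type*} [AddCommGroup V] [Module ℂ V] (H : InnerProductSpace.Core ℂ V) :
    V →ₗ⋆[ℂ] V →ₗ[ℂ] ℂ :=
  LinearMap.mk₂'ₛₗ (starRingEnd ℂ) (RingHom.id ℂ) H.inner H.add_left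
    (fun c u v => H.smul_left u v c)
    (fun u v w => by
      rw [← H.conj_inner_symm, H.add_left, map_add, H.conj_inner_symm, H.conj_inner_symm])
    (fun c u v => by
      rw [← H.conj_inner_symm, H.smul_left, map_mul, H.conj_inner_symm, Complex.conj_conj]
      rfl)

end Diagonalization

/-! ### The balancing map -/

section

variable {n : ℕ} {X : Type*} [TopologicalSpace X] [ChartedSpace (Fin n → ℂ) X]
  [IsManifold 𝓘(ℂ, Fin n → ℂ) ω X] {k : ℕ}

theorem coeff_add (s s' : PluriSection n X k) (x : X) :
    coeff (s + s') x = coeff s x + coeff s' x := rfl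

theorem coeff_smul (c : ℂ) (s : PluriSection n X k) (x : X) :
    coeff (c • s) x = c * coeff s x := rfl

theorem HasWeights.isONB_zero {H : ℝ → HermForm n X k}
    {s : Module.Basis (Fin (sectionDim n X k)) ℂ (PluriSection n X k)}
    {lam : Fin (sectionDim n X k) → ℝ} (hw : HasWeights H s lam) : IsONB (H 0) s := by
  simpa using hw 0

/-- This turns the integrand of `balancing` into N times a pairing divided by the Bergman function.
-/
theorem exp_neg_mul_fubiniStudy [FiniteDimensional ℂ (PluriSection n X k)] [Nonempty X]
    {h : HermitianMetric n X} (hk : k ≠ 0)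
    (hgen : ∀ x : X, ∃ s : PluriSection n X k, coeff s x ≠ 0) (H : HermForm n X k) (x : X) :
    Real.exp (-(k : ℝ) * fubiniStudy h H x) = sectionDim n X k / h.bergman H x := by
  have hN : (0 : ℝ) < sectionDim n X k := Nat.cast_pos.2 (sectionDim_pos hgen)
  have hS := h.bergman_pos H hgen x
  have hk' : (k : ℝ) ≠ 0 := Nat.cast_ne_zero.2 hk
  have h1 : -(k : ℝ) * fubiniStudy h H x =
      -Real.log ((sectionDim n X k : ℝ)⁻¹ * h.bergman H x) := by
    rw [fubiniStudy, HermitianMetric.bergman]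
    field_simp
  rw [h1, Real.exp_neg, Real.exp_log (mul_pos (inv_pos.2 hN) hS), mul_inv, inv_inv, div_eq_mul_inv]

end

section Balancing

variable {n : ℕ} {X : Type*} [TopologicalSpace X] [CompactSpace X] [T2Space X]
  [ChartedSpace (Fin n → ℂ) X] [IsManifold 𝓘(ℂ, Fin n → ℂ) ω X] [MeasurableSpace X] [BorelSpace X]
  {k : ℕ}

/-- The normalized squared length `∫ |s|² / ∑ |s_i|² dμ` of a section for `b_k(H)`. -/
noncomputable def HermitianMetric.density (h : HermitianMetric n X) (ρ : X → ℝ) (H : HermForm n X k)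
    (s : PluriSection n X k) : ℝ :=
  ∫ x, h.normSq s x / h.bergman H x ∂canonicalMeasure h ρ (fubiniStudy h H)

variable {h : HermitianMetric n X} {ρ : X → ℝ}

omit [BorelSpace X] in
theorem isHermitian_formMatrix_balancing (H : HermForm n X k)
    (s : Fin (sectionDim n X k) → PluriSection n X k) :
    (formMatrix (balancing h ρ H) s).IsHermitian := by
  ext i j
  rw [Matrix.conjTranspose_apply, formMatrix, Matrix.of_apply, Matrix.of_apply, balancing, l2Form,
    l2Form, Complex.star_def, ← integral_conj]
  refine integral_congr_ae (ae_of_all _ fun x => ?_)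
  simp only [HermitianMetric.pairing, map_mul, Complex.conj_ofReal, Complex.conj_conj]
  ring

omit [BorelSpace X] in
theorem HermitianMetric.density_nonneg (H : HermForm n X k) (s : PluriSection n X k) :
    0 ≤ h.density ρ H s :=
  integral_nonneg fun x => div_nonneg (h.normSq_nonneg s x)
    (Finset.sum_nonneg fun i _ => h.normSq_nonneg (onb H i) x)

variable [FiniteDimensional ℂ (PluriSection n X k)] [Nonempty X]

omit [BorelSpace X] in
theorem balancing_eq (hk : k ≠ 0)
    (hgen : ∀ x : X, ∃ s : PluriSection n X k, coeff s x ≠ 0) (H : HermForm n X k)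
    (s s' : PluriSection n X k) :
    balancing h ρ H s s' = ∫ x, h.pairing s s' x * ((sectionDim n X k / h.bergman H x : ℝ) : ℂ)
      ∂canonicalMeasure h ρ (fubiniStudy h H) := by
  simp only [balancing, l2Form, exp_neg_mul_fubiniStudy hk hgen]

omit [BorelSpace X] in
theorem balancing_self (hk : k ≠ 0)
    (hgen : ∀ x : X, ∃ s : PluriSection n X k, coeff s x ≠ 0) (H : HermForm n X k)
    (s : PluriSection n X k) :
    balancing h ρ H s s = ((sectionDim n X k * h.density ρ H s : ℝ) : ℂ) := by
  rw [balancing_eq hk hgen, HermitianMetric.density, ← integral_const_mul, ← integral_complex_ofReal]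
  refine integral_congr_ae (ae_of_all _ fun x => ?_)
  simp only [h.pairing_self]
  push_cast
  ring

theorem integrable_balancing (hpos : h.IsPositive) (hρ : Continuous ρ)
    (hgen : ∀ x : X, ∃ s : PluriSection n X k, coeff s x ≠ 0) (H : HermForm n X k)
    (s s' : PluriSection n X k) :
    Integrable (fun x => h.pairing s s' x * ((sectionDim n X k / h.bergman H x : ℝ) : ℂ))
      (canonicalMeasure h ρ (fubiniStudy h H)) := by
  have := isProbabilityMeasure_canonicalMeasure hpos hρ (h.continuous_fubiniStudy H hgen)
  exact integrable_of_continuous ((h.continuous_pairing s s').mul (Complex.continuous_ofReal.comp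
    (continuous_const.div (h.continuous_bergman H) fun x => (h.bergman_pos H hgen x).ne')))

/-- The form `b_k(H)` is sesquilinear. -/
noncomputable def balancingSesquilinear (hpos : h.IsPositive) (hρ : Continuous ρ) (hk : k ≠ 0)
    (hgen : ∀ x : X, ∃ s : PluriSection n X k, coeff s x ≠ 0) (H : HermForm n X k) :
    PluriSection n X k →ₗ⋆[ℂ] PluriSection n X k →ₗ[ℂ] ℂ :=
  LinearMap.mk₂'ₛₗ (starRingEnd ℂ) (RingHom.id ℂ) (balancing h ρ H)
    (fun s s' u => by
      simp only [balancing_eq hk hgen]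
      rw [← integral_add (integrable_balancing hpos hρ hgen H _ _)
        (integrable_balancing hpos hρ hgen H _ _)]
      refine integral_congr_ae (ae_of_all _ fun x => ?_)
      simp only [HermitianMetric.pairing, coeff_add, map_add]
      ring)
    (fun c s u => by
      simp only [balancing_eq hk hgen]
      rw [smul_eq_mul, ← integral_const_mul]
      refine integral_congr_ae (ae_of_all _ fun x => ?_)
      simp only [HermitianMetric.pairing, coeff_smul, map_mul]
      ring)
    (fun s u u' => by
      simp only [balancing_eq hk hgen]
      rw [← integral_add (integrable_balancing hpos hρ hgen H _ _)
        (integrable_balancing hpos hρ hgen H _ _)]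
      refine integral_congr_ae (ae_of_all _ fun x => ?_)
      simp only [HermitianMetric.pairing, coeff_add]
      ring)
    (fun c s u => by
      simp only [balancing_eq hk hgen]
      rw [RingHom.id_apply, smul_eq_mul, ← integral_const_mul]
      refine integral_congr_ae (ae_of_all _ fun x => ?_)
      simp only [HermitianMetric.pairing, coeff_smul]
      ring)

/-- The quotients |s_i|² / ∑ |s_j|² add up to one at every point, and the canonical measure has mass
one. -/
theorem HermitianMetric.sum_density (hpos : h.IsPositive) (hρ : Continuous ρ)
    (hgen : ∀ x : X, ∃ s : PluriSection n X k, coeff s x ≠ 0) {H : HermForm n X k}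
    {s : Fin (sectionDim n X k) → PluriSection n X k} (hs : IsONB H s) :
    ∑ i, h.density ρ H (s i) = 1 := by
  have := isProbabilityMeasure_canonicalMeasure hpos hρ (h.continuous_fubiniStudy H hgen)
  simp only [HermitianMetric.density]
  have hint : ∀ i, Integrable (fun x => h.normSq (s i) x / h.bergman H x)
      (canonicalMeasure h ρ (fubiniStudy h H)) := fun i => integrable_of_continuous
    ((h.continuous_normSq (s i)).div (h.continuous_bergman H) fun x =>
      (h.bergman_pos H hgen x).ne')
  rw [← integral_finsetSum _ fun i _ => hint i]
  have h1 : ∀ x, ∑ i, h.normSq (s i) x / h.bergman H x = 1 := fun x => by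
    rw [← Finset.sum_div, ← h.sum_normSq_onb hs x]
    exact div_self (h.bergman_pos H hgen x).ne'
  simp [h1]

/-- There is an `H`-orthonormal basis that diagonalizes `b_k(H)`; it computes the quantized
entropy. -/
theorem exists_basis_quantizedEntropy_eq (hpos : h.IsPositive) (hρ : Continuous ρ) (hk : k ≠ 0)
    (hgen : ∀ x : X, ∃ s : PluriSection n X k, coeff s x ≠ 0) (H : HermForm n X k) :
    ∃ s : Module.Basis (Fin (sectionDim n X k)) ℂ (PluriSection n X k), IsONB H s ∧
      quantizedEntropy h ρ H =
        ∑ i, h.density ρ H (s i) * Real.log (sectionDim n X k * h.density ρ H (s i)) := by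
  have hN : (0 : ℝ) < sectionDim n X k := Nat.cast_pos.2 (sectionDim_pos hgen)
  set M := formMatrix (balancing h ρ H) (onb H) with hMdef
  have hM : M.IsHermitian := isHermitian_formMatrix_balancing H (onb H)
  have hone : formMatrix H.inner (onb H) = 1 := by
    ext i j
    rw [formMatrix, Matrix.of_apply, isONB_onb H i j, Matrix.one_apply]
  set U : Matrix (Fin (sectionDim n X k)) (Fin (sectionDim n X k)) ℂ :=
    hM.eigenvectorUnitary.1
  have hU : star U * U = 1 := Unitary.coe_star_mul_self hM.eigenvectorUnitary
  set s' : Fin (sectionDim n X k) → PluriSection n X k := fun a => ∑ j, U j a • onb H j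
  have hs' : IsONB H s' := fun a c => by
    have h1 := sesquilinear_apply_sum (coreSesquilinear H) (onb H) U a c
    change H.inner (s' a) (s' c) = (star U * formMatrix H.inner (onb H) * U) a c at h1
    rw [h1, hone, mul_one, hU, Matrix.one_apply]
  obtain ⟨b, hb⟩ : ∃ b : Module.Basis (Fin (sectionDim n X k)) ℂ (PluriSection n X k), ⇑b = s' :=
    exists_basis_of_orthonormal H hs'
  -- The a-th diagonal entry of U* M U is an eigenvalue and also the value of b_k(H) on the rotated
  -- basis vector.
  have heig : ∀ a, hM.eigenvalues a = sectionDim n X k * h.density ρ H (b a) := fun a => by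
    have h1 := sesquilinear_apply_sum (balancingSesquilinear hpos hρ hk hgen H) (onb H) U a a
    change balancing h ρ H (s' a) (s' a) = (star U * M * U) a a at h1
    have h2 := hM.conjStarAlgAut_star_eigenvectorUnitary
    rw [Unitary.conjStarAlgAut_apply, Unitary.coe_star, star_star] at h2
    rw [h2, Matrix.diagonal_apply_eq, ← hb, balancing_self hk hgen] at h1
    exact (Complex.ofReal_injective h1).symm
  refine ⟨b, hb ▸ hs', ?_⟩
  -- In its own orthonormal basis `H` is the identity, so the term log H disappears.
  have hlog : cfc Real.log (1 : Matrix (Fin (sectionDim n X k)) (Fin (sectionDim n X k)) ℂ) = 0 := by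
    rw [cfc_apply_one]
    simp
  rw [quantizedEntropy, relativeEntropy, hone, hlog, sub_zero, ← hMdef, trace_mul_cfc hM,
    Complex.ofReal_re, Finset.mul_sum]
  refine Finset.sum_congr rfl fun a _ => ?_
  rw [heig, ← mul_assoc, ← mul_assoc, inv_mul_cancel₀ hN.ne', one_mul]

end Balancing

/-! ### The entropy inequality -/

section Entropy

/-- Each u_i is at most log ∑ e^{u_j}, hence so is their p-average; log N comes from the
normalization. The sharp Gibbs bound is not needed, since this serves only to show that the supremum
is finite. -/
theorem sum_mul_sub_log_le {ι : Type*} [Fintype ι] {p : ι → ℝ} (hp : ∀ i, 0 ≤ p i)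
    (hp1 : ∑ i, p i = 1) (u : ι → ℝ) {N : ℝ} (hN : 0 < N) :
    ∑ i, p i * u i - Real.log (N⁻¹ * ∑ i, Real.exp (u i)) ≤ Real.log N := by
  have hne : Nonempty ι := by
    by_contra h
    rw [not_nonempty_iff] at h
    simp at hp1
  have hpos : 0 < ∑ i, Real.exp (u i) :=
    Finset.sum_pos (fun i _ => Real.exp_pos _) Finset.univ_nonempty
  have h1 : ∀ i, u i ≤ Real.log (∑ j, Real.exp (u j)) := fun i => by
    rw [Real.le_log_iff_exp_le hpos]
    exact Finset.single_le_sum (f := fun j => Real.exp (u j)) (fun j _ => (Real.exp_pos _).le)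
      (Finset.mem_univ i)
  have h2 : ∑ i, p i * u i ≤ ∑ i, p i * Real.log (∑ j, Real.exp (u j)) :=
    Finset.sum_le_sum fun i _ => mul_le_mul_of_nonneg_left (h1 i) (hp i)
  rw [← Finset.sum_mul, hp1, one_mul] at h2
  rw [Real.log_mul (inv_pos.2 hN).ne' hpos.ne', Real.log_inv]
  linarith

/-- The Gibbs functional at the truncated maximizer u_i = log max(N p_i, ε). Truncation does not
decrease the linear term, and the mean of the maxima is at most 1 + ε, so its logarithm is at most
ε. -/
theorem sum_mul_log_le_add {ι : Type*} [Fintype ι] {p : ι → ℝ} (hp : ∀ i, 0 ≤ p i)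
    (hp1 : ∑ i, p i = 1) (hι : 0 < Fintype.card ι) {ε : ℝ} (hε : 0 < ε) :
    ∑ i, p i * Real.log (Fintype.card ι * p i) ≤
      ∑ i, p i * Real.log (max (Fintype.card ι * p i) ε) -
        Real.log ((Fintype.card ι : ℝ)⁻¹ * ∑ i, max (Fintype.card ι * p i) ε) + ε := by
  have hN : (0 : ℝ) < Fintype.card ι := Nat.cast_pos.2 hι
  have hne : Nonempty ι := Fintype.card_pos_iff.1 hι
  have h1 : ∑ i, p i * Real.log (Fintype.card ι * p i) ≤
      ∑ i, p i * Real.log (max (Fintype.card ι * p i) ε) := by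
    refine Finset.sum_le_sum fun i _ => ?_
    rcases (hp i).eq_or_lt with h0 | h0
    -- For p_i = 0 the factor p_i kills both terms, whatever the logarithms are.
    · simp [← h0]
    · exact mul_le_mul_of_nonneg_left (Real.log_le_log (mul_pos hN h0) (le_max_left _ _)) (hp i)
  have h2 : 0 < (Fintype.card ι : ℝ)⁻¹ * ∑ i, max (Fintype.card ι * p i) ε :=
    mul_pos (inv_pos.2 hN) (Finset.sum_pos (fun i _ => lt_max_of_lt_right hε)
      Finset.univ_nonempty)
  have h3 : (Fintype.card ι : ℝ)⁻¹ * ∑ i, max (Fintype.card ι * p i) ε ≤ 1 + ε := by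
    rw [inv_mul_le_iff₀ hN]
    calc ∑ i, max (Fintype.card ι * p i) ε ≤ ∑ i, (Fintype.card ι * p i + ε) :=
          Finset.sum_le_sum fun i _ => max_le (by linarith)
            (by linarith [mul_nonneg hN.le (hp i)])
      _ = Fintype.card ι * (1 + ε) := by
          rw [Finset.sum_add_distrib, ← Finset.mul_sum, hp1]
          simp
          ring
  have h4 := Real.log_le_sub_one_of_pos h2
  linarith

variable {n : ℕ} {X : Type*} [TopologicalSpace X] [CompactSpace X] [T2Space X]
  [ChartedSpace (Fin n → ℂ) X] [IsManifold 𝓘(ℂ, Fin n → ℂ) ω X] [MeasurableSpace X] [BorelSpace X]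
  {k : ℕ} [FiniteDimensional ℂ (PluriSection n X k)] [Nonempty X]
  {h : HermitianMetric n X} {ρ : X → ℝ}

/-- The slope of `-L` along a geodesic. -/
theorem neg_deriv_lFunctional_eq (hpos : h.IsPositive) (hρ : Continuous ρ)
    (hgen : ∀ x : X, ∃ s : PluriSection n X k, coeff s x ≠ 0) {H : ℝ → HermForm n X k}
    {s : Module.Basis (Fin (sectionDim n X k)) ℂ (PluriSection n X k)}
    {lam : Fin (sectionDim n X k) → ℝ} (hw : HasWeights H s lam) :
    -deriv (fun t => lFunctional h ρ (fubiniStudy h (H t))) 0 =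
      ∑ i, h.density ρ (H 0) (s i) * (-lam i / k) := by
  rw [(hasDerivAt_lFunctional_fubiniStudy hpos hρ hgen hw).deriv, Finset.mul_sum,
    ← Finset.sum_neg_distrib]
  refine Finset.sum_congr rfl fun i _ => ?_
  rw [HermitianMetric.density]
  ring

theorem le_log_of_mem_subtractedSlopes (hpos : h.IsPositive) (hρ : Continuous ρ)
    (hgen : ∀ x : X, ∃ s : PluriSection n X k, coeff s x ≠ 0) {H₀ : HermForm n X k} {v : ℝ}
    (hv : v ∈ subtractedSlopes h ρ H₀) : v ≤ Real.log (sectionDim n X k) := by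
  obtain ⟨H, s, lam, -, rfl, hw, rfl⟩ := hv
  rw [neg_deriv_lFunctional_eq hpos hρ hgen hw]
  exact sum_mul_sub_log_le (fun i => HermitianMetric.density_nonneg (H 0) (s i))
    (HermitianMetric.sum_density hpos hρ hgen hw.isONB_zero) _
    (Nat.cast_pos.2 (sectionDim_pos hgen))

theorem exists_mem_subtractedSlopes (hpos : h.IsPositive) (hρ : Continuous ρ) (hk : k ≠ 0)
    (hgen : ∀ x : X, ∃ s : PluriSection n X k, coeff s x ≠ 0) (H₀ : HermForm n X k) {ε : ℝ}
    (hε : 0 < ε) : ∃ v ∈ subtractedSlopes h ρ H₀, quantizedEntropy h ρ H₀ ≤ v + ε := by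
  obtain ⟨s, hs, hS⟩ := exists_basis_quantizedEntropy_eq hpos hρ hk hgen H₀
  -- The truncated Gibbs maximizer; since u_i stands for -λ_i / k, the geodesic below has weights -k
  -- u_i.
  set u : Fin (sectionDim n X k) → ℝ := fun i =>
    Real.log (max (sectionDim n X k * h.density ρ H₀ (s i)) ε)
  obtain ⟨H, hgeo, rfl, hw⟩ := exists_isGeodesic s hs fun i => -(k * u i)
  have hu : ∀ i, - -(k * u i) / (k : ℝ) = u i := fun i => by
    rw [neg_neg, mul_div_cancel_left₀ _ (Nat.cast_ne_zero.2 hk)]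
  refine ⟨_, ⟨H, s, _, hgeo, rfl, hw, rfl⟩, ?_⟩
  rw [hS, neg_deriv_lFunctional_eq hpos hρ hgen hw]
  simp only [hu]
  have hexp : ∀ i, Real.exp (u i) = max (sectionDim n X k * h.density ρ (H 0) (s i)) ε :=
    fun i => Real.exp_log (lt_max_of_lt_right hε)
  simp only [hexp]
  have := sum_mul_log_le_add (fun i => HermitianMetric.density_nonneg (h := h) (ρ := ρ) (H 0) (s i))
    (HermitianMetric.sum_density hpos hρ hgen hs)
    (by rw [Fintype.card_fin]; exact sectionDim_pos hgen) hε
  simpa only [Fintype.card_fin] using this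

end Entropy

end QuantizedEntropy

theorem mainTheorem6 {n : ℕ} {X : Type*} [TopologicalSpace X] [CompactSpace X] [T2Space X]
    [ConnectedSpace X] [ChartedSpace (Fin n → ℂ) X] [IsManifold 𝓘(ℂ, Fin n → ℂ) ω X]
    [MeasurableSpace X] [BorelSpace X]
    (h₀ : QuantizedEntropy.HermitianMetric n X) (hpos : h₀.IsPositive)
    (ρ₀ : X → ℝ) (hρ : QuantizedEntropy.IsRicciPotential h₀ ρ₀)
    (k : ℕ) (hk : 1 ≤ k)
    (hgen : ∀ x : X, ∃ s : QuantizedEntropy.PluriSection n X k, QuantizedEntropy.coeff s x ≠ 0)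
    (H₀ : QuantizedEntropy.HermForm n X k) :
    (∀ (H : ℝ → QuantizedEntropy.HermForm n X k)
      (s : Module.Basis (Fin (QuantizedEntropy.sectionDim n X k)) ℂ
        (QuantizedEntropy.PluriSection n X k))
      (lam : Fin (QuantizedEntropy.sectionDim n X k) → ℝ),
      QuantizedEntropy.IsGeodesic H → H 0 = H₀ → QuantizedEntropy.HasWeights H s lam →
      DifferentiableAt ℝ (fun t => QuantizedEntropy.lFunctional h₀ ρ₀
        (QuantizedEntropy.fubiniStudy h₀ (H t))) 0) ∧
    BddAbove (QuantizedEntropy.subtractedSlopes h₀ ρ₀ H₀) ∧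
    QuantizedEntropy.quantizedEntropy h₀ ρ₀ H₀ ≤
      sSup (QuantizedEntropy.subtractedSlopes h₀ ρ₀ H₀) := by
  have hρc : Continuous ρ₀ := hρ.smooth.continuous
  have hk0 : k ≠ 0 := Nat.one_le_iff_ne_zero.1 hk
  have := h₀.finiteDimensional_pluriSection k
  have hbdd : BddAbove (QuantizedEntropy.subtractedSlopes h₀ ρ₀ H₀) :=
    ⟨_, fun _ hv => QuantizedEntropy.le_log_of_mem_subtractedSlopes hpos hρc hgen hv⟩
  refine ⟨fun H s lam _ _ hw =>
    (QuantizedEntropy.hasDerivAt_lFunctional_fubiniStudy hpos hρc hgen hw).differentiableAt,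
    hbdd, le_of_forall_pos_le_add fun ε hε => ?_⟩
  obtain ⟨v, hv, hle⟩ :=
    QuantizedEntropy.exists_mem_subtractedSlopes hpos hρc hk0 hgen H₀ hε
  exact hle.trans (add_le_add_left (le_csSup hbdd hv) ε)
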